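/- Let $n\ge 1$, let $X\subset\mathbb R^n$ be compact, let $f:X\to X$ be continuous, and let $\sigma>0$ be such that $f(x)+w\in X$ for all $x\in X$ and $w\in[-\sigma,\sigma]^n$. Let $\Omega=([-\sigma,\sigma]^n)^{\mathbb N}$ carry the law $\mathbb P$ of an i.i.d. sequence of uniformly distributed points of $[-\sigma,\sigma]^n$, and put $f_\omega(x)=f(x)+\omega_0$ for $\omega=(\omega_i)_{i\ge0}\in\Omega$. Let $\mathcal C\subset X$ be the critical set, i.e. the set of points where the derivative $df$ of $f$ (taken within $X$) does not exist, is not uniquely determined, or is not invertible. Assume that $df$ is locally Hölder continuous on $X\setminus\mathcal C$ with some exponent $\alpha>0$, and that: (H1) $\mathcal C$ is contained in a finite union of images of $C^1$ maps $[0,1]^{n-1}\to\mathbb R^n$, and there are constants $B>1$, $\beta>0$ such that (these bounds being void if $\mathcal C=\emptyset$) - $\frac1B\,\mathrm{dist}(x,\mathcal C)^{\beta}\|v\|\le\|df(x)v\|\le B\,\mathrm{dist}(x,\mathcal C)^{-\beta}\|v\|$ for all $x\in X\setminus\mathcal C$ and $v\in\mathbb R^n$; - for all $x,y\in X\setminus\mathcal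 C$ with $|x-y|\le\mathrm{dist}(x,\mathcal C)/2$, both $\bigl|\log\|df(x)^{-1}\|-\log\|df(y)^{-1}\|\bigr|$ and $\bigl|\log|\det df(x)|-\log|\det df(y)|\bigr|$ are at most $B\,\mathrm{dist}(x,\mathcal C)^{-\beta}|x-y|$. (In case $\mathrm{dist}(x,\mathcal C)=0$, $\mathrm{dist}(x,\mathcal C)^{-\beta}$ is read as $+\infty$.) (H2) $Y\subset X$ is a nonempty compact set with $f(x)+w\in Y$ for all $x\in Y$, $w\in[-\sigma,\sigma]^n$, the Markov process on $Y$ with transition kernel $\mathcal P_x(A)=\mathbb P(f_\omega(x)\in A)$ is uniquely ergodic, i.e. has exactly one stationary probability measure $\mu$, and, with $g(x)=\log\|df(x)^{-1}\|$, $$\lambda=\int_Y g\,d\mu<0 .$$ Then for all sufficiently small $\theta>0$ the formula $$P_\theta h(x)=\mathbb E\bigl[(e^{\theta g}h)\circ f_\omega(x)\bigr],\qquad h\in C^0(Y),\ x\in Y,$$ has absolutely convergent expectations and defines a bounded operator $P_\theta$ on the space $C^0(Y)$ of complex-valued continuous functions; its spectral radius $\lambda_\theta$ is an eigenvalue of $P_\theta$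 (the leading eigenvalue); and, as $\theta\to0^+$, $$\lambda_\theta=1+\theta\lambda+O(\theta^{4/3})\qquad\text{and}\qquad \lambda_\theta=e^{\theta\lambda}+O(\theta^{4/3}).$$ -/

import Mathlib

open MeasureTheory Set Filter Topology Asymptotics

noncomputable section

namespace RandomHorseshoe

/-- The cube `[-σ, σ]^n`, as a subset of Euclidean space. -/
def cube (n : ℕ) (σ : ℝ) : Set (EuclideanSpace ℝ (Fin n)) :=
  {w | ∀ i, w i ∈ Icc (-σ) σ}

/-- The uniform probability measure on the cube `[-σ, σ]^n`:
normalized Lebesgue measure, i.e. the `n`-fold product of `Leb / (2σ)` on `[-σ, σ]`. -/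
def noise (n : ℕ) (σ : ℝ) : Measure (cube n σ) :=
  (volume (cube n σ))⁻¹ • (volume : Measure (EuclideanSpace ℝ (Fin n))).comap Subtype.val

theorem cube_eq_preimage (n : ℕ) (σ : ℝ) :
    cube n σ = (WithLp.ofLp : EuclideanSpace ℝ (Fin n) → (Fin n → ℝ)) ⁻¹'
      (Set.pi univ fun _ => Icc (-σ) σ) := by
  ext w
  simp only [cube, mem_ofPred_eq, mem_preimage, mem_univ_pi]

theorem measurableSet_cube (n : ℕ) (σ : ℝ) : MeasurableSet (cube n σ) := by
  rw [cube_eq_preimage]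
  exact (MeasurableSet.univ_pi fun _ => measurableSet_Icc).preimage
    (PiLp.volume_preserving_ofLp (Fin n)).measurable

theorem volume_cube (n : ℕ) (σ : ℝ) : volume (cube n σ) = ENNReal.ofReal (2 * σ) ^ n := by
  rw [cube_eq_preimage, (PiLp.volume_preserving_ofLp (Fin n)).measure_preimage
    (MeasurableSet.univ_pi fun _ => measurableSet_Icc).nullMeasurableSet, volume_pi_pi]
  simp [Real.volume_Icc, two_mul]

theorem isProbabilityMeasure_noise (n : ℕ) {σ : ℝ} (hσ : 0 < σ) :
    IsProbabilityMeasure (noise n σ) := by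
  constructor
  have h : (volume : Measure (EuclideanSpace ℝ (Fin n))).comap
      (Subtype.val : cube n σ → _) univ = volume (cube n σ) := by
    rw [comap_subtype_coe_apply (measurableSet_cube n σ)]
    simp
  rw [noise, Measure.smul_apply, h, smul_eq_mul, volume_cube]
  refine ENNReal.inv_mul_cancel (pow_ne_zero _ ?_) (ENNReal.pow_ne_top ENNReal.ofReal_ne_top)
  simpa using hσ

/-- A continuous map `f` of a compact set `X ⊆ ℝⁿ`, together with an amplitude `σ > 0` of
additive noise which keeps `X` invariant. (Only the values of `f` on `X` matter.) -/
structure NoisyMap (n : ℕ) where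
  X : Set (EuclideanSpace ℝ (Fin n))
  isCompact_X : IsCompact X
  f : EuclideanSpace ℝ (Fin n) → EuclideanSpace ℝ (Fin n)
  continuousOn_f : ContinuousOn f X
  σ : ℝ
  σ_pos : 0 < σ
  add_mem : ∀ x ∈ X, ∀ w ∈ cube n σ, f x + w ∈ X

namespace NoisyMap

variable {n : ℕ} (S : NoisyMap n)

/-- The space of noise realizations `Ω = ([-σ,σ]^n)^ℕ`. -/
abbrev Ω : Type := ℕ → cube n S.σ

instance : IsProbabilityMeasure (noise n S.σ) := isProbabilityMeasure_noise n S.σ_pos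

/-- The i.i.d. uniform law `ℙ` on `Ω`. -/
def ℙ : Measure S.Ω := Measure.infinitePi fun _ => noise n S.σ

/-- The derivative of `f : X → X`, taken within `X`. -/
def df (x : EuclideanSpace ℝ (Fin n)) :
    EuclideanSpace ℝ (Fin n) →L[ℝ] EuclideanSpace ℝ (Fin n) :=
  fderivWithin ℝ S.f S.X x

/-- The inverse of the derivative; meaningful off the critical set. -/
def dfInv (x : EuclideanSpace ℝ (Fin n)) :
    EuclideanSpace ℝ (Fin n) →L[ℝ] EuclideanSpace ℝ (Fin n) :=
  (S.df x).inverse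

/-- The critical set `𝒞`: the points of `X` where the (uniquely determined) derivative of
`f : X → X` does not exist or is not invertible. -/
def crit : Set (EuclideanSpace ℝ (Fin n)) :=
  {x ∈ S.X | ¬ (UniqueDiffWithinAt ℝ S.X x ∧ DifferentiableWithinAt ℝ S.f S.X x ∧
    (S.df x).IsInvertible)}

/-- The observable `g(x) = log ‖df(x)⁻¹‖`. -/
def g (x : EuclideanSpace ℝ (Fin n)) : ℝ := Real.log ‖S.dfInv x‖

/-- `f` is of class `C^{1+α}` off the critical set, for some `α > 0`: the derivative is
locally `α`-Hölder on `X \ 𝒞`. -/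
def IsC1Holder : Prop :=
  ∃ α : ℝ, 0 < α ∧ ∀ x ∈ S.X \ S.crit, ∃ K r : ℝ, 0 < r ∧
    ∀ y ∈ S.X \ S.crit, ∀ z ∈ S.X \ S.crit, dist y x < r → dist z x < r →
      ‖S.df y - S.df z‖ ≤ K * dist y z ^ α

/-- Non-degeneracy of the critical set. The bounds by negative powers of `dist(x, 𝒞)` are
written after multiplication by `dist(x, 𝒞)^β`, so that they say nothing where
`dist(x, 𝒞) = 0`; as `Metric.infDist x ∅ = 0`, they are void if `𝒞` is empty. -/
structure NondegenerateCrit : Prop where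
  /-- `𝒞` lies in a finite union of `C¹`-parametrized hypersurface pieces. -/
  exists_param : ∃ (N : ℕ) (φ : Fin N → (Fin (n - 1) → ℝ) → EuclideanSpace ℝ (Fin n)),
    (∀ i, ContDiffOn ℝ 1 (φ i) (Icc 0 1)) ∧ S.crit ⊆ ⋃ i, φ i '' Icc 0 1
  exists_bounds : ∃ B β : ℝ, 1 < B ∧ 0 < β ∧
    (∀ x ∈ S.X \ S.crit, ∀ v : EuclideanSpace ℝ (Fin n),
      1 / B * Metric.infDist x S.crit ^ β * ‖v‖ ≤ ‖S.df x v‖ ∧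
      Metric.infDist x S.crit ^ β * ‖S.df x v‖ ≤ B * ‖v‖) ∧
    (∀ x ∈ S.X \ S.crit, ∀ y ∈ S.X \ S.crit, dist x y ≤ Metric.infDist x S.crit / 2 →
      Metric.infDist x S.crit ^ β * |Real.log ‖S.dfInv x‖ - Real.log ‖S.dfInv y‖|
        ≤ B * dist x y ∧
      Metric.infDist x S.crit ^ β * |Real.log (abs (S.df x).det) - Real.log (abs (S.df y).det)|
        ≤ B * dist x y)

/-- A nonempty compact subset `Y ⊆ X` that is invariant under all the maps `x ↦ f(x) + w`. -/
structure Component where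
  Y : Set (EuclideanSpace ℝ (Fin n))
  subset_X : Y ⊆ S.X
  isCompact_Y : IsCompact Y
  nonempty_Y : Y.Nonempty
  add_mem : ∀ x ∈ Y, ∀ w ∈ cube n S.σ, S.f x + w ∈ Y

namespace Component

variable {S} (C : S.Component)

instance : CompactSpace C.Y := isCompact_iff_compactSpace.mp C.isCompact_Y

/-- The random map `f_ω(x) = f(x) + ω₀`, restricted to `Y`. -/
def step (ω : S.Ω) (x : C.Y) : C.Y :=
  ⟨S.f x + (ω 0 : EuclideanSpace ℝ (Fin n)), C.add_mem x x.2 _ (ω 0).2⟩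

/-- `μ` is a stationary measure of the Markov process on `Y` with transition kernel
`𝒫_x(A) = ℙ(f_ω(x) ∈ A)`. -/
def IsStationary (μ : Measure C.Y) : Prop :=
  ∀ A : Set C.Y, MeasurableSet A → μ A = ∫⁻ x, S.ℙ {ω | C.step ω x ∈ A} ∂μ

/-- The process on `Y` is uniquely ergodic: `μ` is its only stationary probability measure. -/
structure IsUniquelyErgodic (μ : Measure C.Y) : Prop where
  isProbabilityMeasure : IsProbabilityMeasure μ
  isStationary : C.IsStationary μ
  unique : ∀ μ' : Measure C.Y, IsProbabilityMeasure μ' → C.IsStationary μ' → μ' = μ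

/-- `λ = ∫_Y log ‖df(x)⁻¹‖ dμ(x)`. -/
def exponent (μ : Measure C.Y) : ℝ := ∫ x : C.Y, S.g x ∂μ

/-- `T` is the twisted transfer operator `P_θ` on `C⁰(Y)`, i.e.
`(P_θ h)(x) = 𝔼[(e^{θ g} h) ∘ f_ω(x)]`, the expectations being absolutely convergent. -/
structure IsTwistedTransferOperator (θ : ℝ) (T : C(C.Y, ℂ) →L[ℂ] C(C.Y, ℂ)) : Prop where
  integrable : ∀ x : C.Y, Integrable (fun ω => Real.exp (θ * S.g (C.step ω x))) S.ℙ
  apply_eq : ∀ (h : C(C.Y, ℂ)) (x : C.Y),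
    T h x = ∫ ω, (Real.exp (θ * S.g (C.step ω x)) : ℂ) * h (C.step ω x) ∂S.ℙ

end Component

end NoisyMap

/-- `r` is the leading eigenvalue of `T`: an eigenvalue equal to the spectral radius. -/
structure IsLeadingEigenvalue {V : Type*} [NormedAddCommGroup V] [NormedSpace ℂ V]
    (T : V →L[ℂ] V) (r : ℝ) : Prop where
  hasEigenvalue : Module.End.HasEigenvalue (T : V →ₗ[ℂ] V) (r : ℂ)
  spectralRadius_eq : spectralRadius ℂ T = ENNReal.ofReal r
  nonneg : 0 ≤ r

end RandomHorseshoe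

end

/-!
Let `ν` be Lebesgue measure on `Y`, normalized so that `W x = f x + [-σ, σ]ⁿ` has mass `1`. Then
`P_θ h (x) = ∫_{W x} e^{θ g} h dν`. Since `W x` varies continuously in measure, `P_θ` is a compact
operator on `C⁰(Y)` as soon as `e^{θ g}` is integrable, and `‖P_θ - P_0‖ ≤ ∫ |e^{θ g} - 1| dν`.
By (H1), `|g|` is at most a constant plus `β |log dist(·, 𝒞)|`, while the `r`-neighbourhood of `𝒞`
has measure `O(r)`; hence `g` has exponential moments with respect to `ν`, and `P_θ - P_0 = O(θ)`.

A continuous function fixed by `P_0` has the same integral against the initial law `δ_x` as against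
the stationary measure obtained from it by averaging over time. Unique ergodicity therefore makes
such a function constant, so that `1` is a simple eigenvalue of `P_0`, with left eigenvector `μ`.
The implicit function theorem continues it to an eigenpair `(λ_θ, h_θ)` of `P_θ` with
`λ_θ = 1 + μ((P_θ - P_0) 1) + O(θ²) = ∫ e^{θ g} dμ + O(θ²) = 1 + θ λ + O(θ²)`. As `h_θ` is close to
`1`, it is positive, and `λ_θ` is the operator norm of `P_θ` for the norm `sup |v / h_θ|`; hence it
is the spectral radius.
-/

noncomputable section

namespace RandomHorseshoe

open ProbabilityTheory
open scoped symmDiff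

section Perturbation

variable {𝕜 E : Type*} [NontriviallyNormedField 𝕜] [NormedAddCommGroup E] [NormedSpace 𝕜 E]
  {P : E →L[𝕜] E} {z₀ : 𝕜} {e : E} {ℓ : E →L[𝕜] 𝕜}

/-- `z₀` is a simple eigenvalue of `P`, with eigenvector `e` and left eigenvector `ℓ`, normalised
by `ℓ e = 1`. Simplicity is expressed through the rank one perturbation `z₀ - P + ℓ(·)e`, which
fixes `e` and restricts to `z₀ - P` on the `P`-invariant complement `ker ℓ` of `e`. -/
structure IsSimpleEigentriple (P : E →L[𝕜] E) (z₀ : 𝕜) (e : E) (ℓ : E →L[𝕜] 𝕜) : Prop where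
  apply_right : P e = z₀ • e
  apply_left : ∀ x, ℓ (P x) = z₀ * ℓ x
  pairing : ℓ e = 1
  isUnit : IsUnit (algebraMap 𝕜 (E →L[𝕜] E) z₀ - P + ℓ.smulRight e)

/-- The map whose zeros with respect to `(x, z)`, up to the constant `(0, 1)`, are the eigenpairs
of `T` normalised by `ℓ x = 1`. -/
def eigenpairMap (ℓ : E →L[𝕜] 𝕜) (p : (E →L[𝕜] E) × E × 𝕜) : E × 𝕜 :=
  (p.1 p.2.1 - p.2.2 • p.2.1, ℓ p.2.1)

theorem hasStrictFDerivAt_eigenpairMap (ℓ : E →L[𝕜] 𝕜) (p : (E →L[𝕜] E) × E × 𝕜) :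
    ∃ D : (E →L[𝕜] E) × E × 𝕜 →L[𝕜] E × 𝕜, HasStrictFDerivAt (eigenpairMap ℓ) D p ∧
      ∀ q, D q = (p.1 q.2.1 + q.1 p.2.1 - (p.2.2 • q.2.1 + q.2.2 • p.2.1), ℓ q.2.1) := by
  have hT := hasStrictFDerivAt_fst (𝕜 := 𝕜) (p := p)
  have hxz := hasStrictFDerivAt_snd (𝕜 := 𝕜) (p := p)
  exact ⟨_, ((hT.clm_apply hxz.fst).sub (hxz.snd.smul hxz.fst)).prodMk
    (ℓ.hasStrictFDerivAt.comp p hxz.fst), fun q => by simp⟩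

theorem isSimpleEigentriple_of_isCompactOperator [LocallyCompactSpace 𝕜] [CompleteSpace E]
    (hP : IsCompactOperator P) (hz₀ : z₀ ≠ 0)
    (hPe : P e = z₀ • e) (hℓP : ∀ x, ℓ (P x) = z₀ * ℓ x) (hℓe : ℓ e = 1)
    (hker : ∀ x, P x = z₀ • x → ℓ x = 0 → x = 0) : IsSimpleEigentriple P z₀ e ℓ := by
  refine ⟨hPe, hℓP, hℓe, ?_⟩
  have hK : IsCompactOperator (P - ℓ.smulRight e) := hP.sub <|
    (isCompactOperator_id (E := 𝕜)).clm_comp (ContinuousLinearMap.toSpanSingleton 𝕜 e)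
      |>.comp_clm ℓ
  rcases hK.hasEigenvalue_or_mem_resolventSet hz₀ with h | h
  · obtain ⟨x, hx⟩ := h.exists_hasEigenvector
    have hPx : P x - ℓ x • e = z₀ • x := by simpa using hx.apply_eq_smul
    have hℓx : ℓ x = 0 := by
      have := congrArg ℓ hPx
      rwa [map_sub, map_smul, map_smul, hℓP, hℓe, smul_eq_mul, smul_eq_mul, mul_one,
        sub_eq_self] at this
    exact absurd (hker x (by simpa [hℓx] using hPx) hℓx) hx.2
  · simpa only [sub_add] using spectrum.mem_resolventSet_iff.1 h

namespace IsSimpleEigentriple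

theorem isInvertible_partialDeriv (h : IsSimpleEigentriple P z₀ e ℓ)
    {D : E × 𝕜 →L[𝕜] E × 𝕜} (hD : ∀ q, D q = (P q.1 - (z₀ • q.1 + q.2 • e), ℓ q.1)) :
    D.IsInvertible := by
  obtain ⟨u, hu⟩ := h.isUnit
  set R : E →L[𝕜] E := u⁻¹.val
  have hA : ∀ x, u.val x = z₀ • x - P x + ℓ x • e := fun x => by
    simp [hu, Algebra.algebraMap_eq_smul_one]
  have hRA : ∀ x, R (z₀ • x - P x + ℓ x • e) = x := fun x => by
    rw [← hA]; exact DFunLike.congr_fun u.inv_mul x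
  have hAR : ∀ x, z₀ • R x - P (R x) + ℓ (R x) • e = x := fun x => by
    rw [← hA]; exact DFunLike.congr_fun u.mul_inv x
  have hRe : R e = e := by simpa [h.apply_right, h.pairing] using hRA e
  have hℓR : ∀ x, ℓ (R x) = ℓ x := fun x => by
    simpa [h.apply_left, h.pairing] using congrArg ℓ (hAR x)
  have hPR : ∀ x, P (R x) = z₀ • R x + ℓ x • e - x := fun x => by
    linear_combination (norm := module) -hAR x + hℓR x • e
  refine .of_inverse (g := (((ContinuousLinearMap.snd 𝕜 E 𝕜 + ℓ ∘L .fst 𝕜 E 𝕜).smulRight e -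
    R ∘L .fst 𝕜 E 𝕜).prod (-ℓ ∘L .fst 𝕜 E 𝕜))) ?_ ?_
  · refine ContinuousLinearMap.ext fun ⟨a, b⟩ => ?_
    rw [ContinuousLinearMap.comp_apply, hD]
    simp only [ContinuousLinearMap.prod_apply, sub_apply, ContinuousLinearMap.smulRight_apply,
      add_apply, ContinuousLinearMap.coe_snd', ContinuousLinearMap.comp_apply,
      ContinuousLinearMap.coe_fst', neg_apply, map_sub, map_smul, h.apply_right, hPR, neg_smul,
      h.pairing, smul_eq_mul, mul_one, hℓR, add_sub_cancel_right, ContinuousLinearMap.id_apply,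
      Prod.mk.injEq, and_true]
    module
  · refine ContinuousLinearMap.ext fun ⟨k, w⟩ => ?_
    rw [ContinuousLinearMap.comp_apply, hD]
    have hk := hRA k
    simp only [map_add, map_sub, map_smul, hRe, ContinuousLinearMap.prod_apply, sub_apply,
      ContinuousLinearMap.smulRight_apply, add_apply, ContinuousLinearMap.coe_snd',
      ContinuousLinearMap.comp_apply, ContinuousLinearMap.coe_fst', h.apply_left, smul_eq_mul,
      h.pairing, mul_one, sub_add_cancel_left, neg_apply, neg_neg, ContinuousLinearMap.id_apply,
      Prod.mk.injEq, and_true] at hk ⊢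
    linear_combination (norm := module) hk

theorem exists_perturbation [CompleteSpace 𝕜] [CompleteSpace E]
    (h : IsSimpleEigentriple P z₀ e ℓ) :
    ∃ (z : (E →L[𝕜] E) → 𝕜) (x : (E →L[𝕜] E) → E),
      (∀ᶠ T in 𝓝 P, T (x T) = z T • x T) ∧ Tendsto x (𝓝 P) (𝓝 e) ∧
        (fun T => z T - z₀ - ℓ ((T - P) e)) =O[𝓝 P] fun T => ‖T - P‖ ^ 2 := by
  obtain ⟨D, hF, hD⟩ := hasStrictFDerivAt_eigenpairMap ℓ (P, e, z₀)
  have hinv : (D ∘L .inr 𝕜 (E →L[𝕜] E) (E × 𝕜)).IsInvertible :=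
    h.isInvertible_partialDeriv fun q => by simp [hD]
  set ψ := hF.implicitFunctionOfProdDomain hinv
  have hψ : Tendsto ψ (𝓝 P) (𝓝 (e, z₀)) := hF.tendsto_implicitFunctionOfProdDomain hinv
  have hsol : ∀ᶠ T in 𝓝 P, T (ψ T).1 = (ψ T).2 • (ψ T).1 ∧ ℓ (ψ T).1 = 1 := by
    filter_upwards [hF.eventually_apply_implicitFunctionOfProdDomain hinv] with T hT
    simpa [eigenpairMap, h.apply_right, h.pairing, sub_eq_zero] using hT
  have hlip : (fun T => (ψ T).1 - e) =O[𝓝 P] fun T => T - P := by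
    have hd := (hF.hasStrictFDerivAt_implicitFunctionOfProdDomain hinv).hasFDerivAt.fst
    simpa [tendsto_nhds_unique hd.continuousAt.tendsto hψ.fst_nhds] using hd.isBigO_sub
  refine ⟨fun T => (ψ T).2, fun T => (ψ T).1, hsol.mono fun T hT => hT.1, hψ.fst_nhds, ?_⟩
  have hz : (fun T => (ψ T).2 - z₀ - ℓ ((T - P) e)) =ᶠ[𝓝 P]
      fun T => ℓ ((T - P) ((ψ T).1 - e)) := by
    filter_upwards [hsol] with T hT
    simp [hT.1, hT.2, h.apply_left, h.pairing]
  calc (fun T => (ψ T).2 - z₀ - ℓ ((T - P) e))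
      =O[𝓝 P] fun T => ℓ ((T - P) ((ψ T).1 - e)) := hz.isBigO
    _ =O[𝓝 P] fun T => (T - P) ((ψ T).1 - e) := ℓ.isBigO_comp _ _
    _ =O[𝓝 P] fun T => ‖T - P‖ * ‖(ψ T).1 - e‖ :=
        .of_norm_le fun T => (T - P).le_opNorm _
    _ =O[𝓝 P] fun T => ‖T - P‖ ^ 2 := by
        simpa only [sq] using (isBigO_refl _ _).mul hlip.norm_norm

end IsSimpleEigentriple

end Perturbation

section Averages

theorem norm_setIntegral_sub_setIntegral_le {Y G : Type*} [MeasurableSpace Y]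
    [NormedAddCommGroup G] [NormedSpace ℝ G] {ν : Measure Y} {F : Y → G} (hF : Integrable F ν)
    {A B : Set Y} (hA : MeasurableSet A) (hB : MeasurableSet B) :
    ‖∫ y in A, F y ∂ν - ∫ y in B, F y ∂ν‖ ≤ ∫ y in A ∆ B, ‖F y‖ ∂ν := by
  have hsub : ∫ y in A, F y ∂ν - ∫ y in B, F y ∂ν =
      ∫ y in A \ B, F y ∂ν - ∫ y in B \ A, F y ∂ν := by
    rw [← integral_inter_add_sdiff hB hF.integrableOn (s := A),
      ← integral_inter_add_sdiff hA hF.integrableOn (s := B), inter_comm B A]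
    abel
  calc ‖∫ y in A, F y ∂ν - ∫ y in B, F y ∂ν‖
      ≤ ∫ y in A \ B, ‖F y‖ ∂ν + ∫ y in B \ A, ‖F y‖ ∂ν := by
        rw [hsub]
        exact (norm_sub_le _ _).trans
          (add_le_add (norm_integral_le_integral_norm _) (norm_integral_le_integral_norm _))
    _ = ∫ y in A ∆ B, ‖F y‖ ∂ν :=
        (setIntegral_union disjoint_sdiff_sdiff (hB.diff hA) hF.norm.integrableOn
          hF.norm.integrableOn).symm

theorem isCompact_closure_of_equicontinuous {X β : Type*} [TopologicalSpace X] [CompactSpace X]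
    [PseudoMetricSpace β] [T2Space β] {S : Set C(X, β)} {K : Set β} (hK : IsCompact K)
    (hSK : ∀ f ∈ S, ∀ x, f x ∈ K) (hS : Equicontinuous ((↑) : S → X → β)) :
    IsCompact (closure S) := by
  let Φ := ContinuousMap.isometryEquivBoundedOfCompact X β
  have hequi : Equicontinuous ((↑) : Φ '' S → X → β) := by
    refine fun x U hU => (hS x U hU).mono fun x' hx' => ?_
    rintro ⟨_, f, hf, rfl⟩
    exact hx' ⟨f, hf⟩
  have hcomp : IsCompact (closure (Φ '' S)) := by
    refine BoundedContinuousFunction.arzela_ascoli K hK _ ?_ hequi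
    rintro _ x ⟨f, hf, rfl⟩
    exact hSK f hf x
  exact Φ.toHomeomorph.isCompact_image.1 (Φ.toHomeomorph.image_closure S ▸ hcomp)

/-- A family of measurable sets `W x` that depends continuously on `x` with respect to the
pseudo-distance `ν (A ∆ B)`. -/
structure IsContinuousInMeasure {X Y : Type*} [TopologicalSpace X] [MeasurableSpace Y]
    (ν : Measure Y) (W : X → Set Y) : Prop where
  measurableSet : ∀ x, MeasurableSet (W x)
  tendsto_symmDiff : ∀ x, Tendsto (fun x' => ν (W x' ∆ W x)) (𝓝 x) (𝓝 0)

namespace IsContinuousInMeasure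

section SetIntegral

variable {X Y : Type*} [TopologicalSpace X] [MeasurableSpace Y] {ν : Measure Y} {W : X → Set Y}

theorem tendsto_setIntegral_symmDiff (hW : IsContinuousInMeasure ν W) {F : Y → ℝ}
    (hF : Integrable F ν) (x : X) :
    Tendsto (fun x' => ∫ y in W x' ∆ W x, F y ∂ν) (𝓝 x) (𝓝 0) :=
  hF.tendsto_setIntegral_nhds_zero (hW.tendsto_symmDiff x)

theorem continuous_setIntegral (hW : IsContinuousInMeasure ν W) {G : Type*}
    [NormedAddCommGroup G] [NormedSpace ℝ G] {F : Y → G} (hF : Integrable F ν) :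
    Continuous fun x => ∫ y in W x, F y ∂ν :=
  continuous_iff_continuousAt.2 fun x => tendsto_iff_norm_sub_tendsto_zero.2 <|
    squeeze_zero (fun _ => norm_nonneg _)
      (fun x' => norm_setIntegral_sub_setIntegral_le hF (hW.measurableSet x') (hW.measurableSet x))
      (hW.tendsto_setIntegral_symmDiff hF.norm x)

/-- The kernel `x ↦ ν|_{W x}`. -/
def kernel [MeasurableSpace X] [OpensMeasurableSpace X] [IsFiniteMeasure ν]
    (hW : IsContinuousInMeasure ν W) : Kernel X Y where
  toFun x := ν.restrict (W x)
  measurable' := by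
    refine Measure.measurable_of_measurable_coe _ fun A hA => ?_
    have hcont : Continuous fun x => (ν.restrict (W x)).real A := by
      simpa [integral_indicator hA] using
        hW.continuous_setIntegral ((integrable_const (1 : ℝ)).indicator hA)
    simpa using hcont.measurable.ennreal_ofReal

theorem kernel_apply [MeasurableSpace X] [OpensMeasurableSpace X] [IsFiniteMeasure ν]
    (hW : IsContinuousInMeasure ν W) (x : X) : hW.kernel x = ν.restrict (W x) := rfl

theorem le_of_invariant_kernel {W : Y → Set Y} [TopologicalSpace Y] [OpensMeasurableSpace Y]
    [IsFiniteMeasure ν] {hW : IsContinuousInMeasure ν W} {μ : Measure Y}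
    [IsProbabilityMeasure μ] (hμ : hW.kernel.Invariant μ) : μ ≤ ν := by
  refine Measure.le_iff.2 fun A hA => ?_
  calc μ A = ∫⁻ x, ν.restrict (W x) A ∂μ := by
        conv_lhs => rw [← hμ, Measure.bind_apply hA hW.kernel.aemeasurable]
        rfl
    _ ≤ ∫⁻ _, ν A ∂μ := lintegral_mono fun x => Measure.restrict_apply_le _ _
    _ = ν A := by simp

end SetIntegral

end IsContinuousInMeasure

theorem norm_setIntegral_smul_le {Y 𝕜 : Type*} [TopologicalSpace Y] [CompactSpace Y]
    [MeasurableSpace Y] [RCLike 𝕜] {ν : Measure Y} {w : Y → ℝ}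
    (hw : Integrable w ν) (h : C(Y, 𝕜)) (A : Set Y) :
    ‖∫ y in A, w y • h y ∂ν‖ ≤ (∫ y in A, ‖w y‖ ∂ν) * ‖h‖ := by
  rw [← integral_mul_const]
  refine norm_integral_le_of_norm_le (hw.norm.restrict.mul_const _) (.of_forall fun y => ?_)
  rw [norm_smul]
  gcongr
  exact h.norm_coe_le_norm y

theorem integrable_smul_continuousMap {Y 𝕜 : Type*} [TopologicalSpace Y] [CompactSpace Y]
    [MeasurableSpace Y] [OpensMeasurableSpace Y] [RCLike 𝕜] {ν : Measure Y} {w : Y → ℝ}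
    (hw : Integrable w ν) (h : C(Y, 𝕜)) : Integrable (fun y => w y • h y) ν :=
  hw.smul_bdd ‖h‖ h.continuous.aestronglyMeasurable
    (Eventually.of_forall h.norm_coe_le_norm)

namespace IsContinuousInMeasure

variable (𝕜 : Type*) {X Y : Type*} [RCLike 𝕜] [TopologicalSpace X] [CompactSpace X]
  [TopologicalSpace Y] [CompactSpace Y] [MeasurableSpace Y] [OpensMeasurableSpace Y]
  {ν : Measure Y} {W : X → Set Y} {w w' : Y → ℝ}

open Classical in
/-- The weighted averaging operator `h ↦ (x ↦ ∫_{W x} w h dν)` on continuous functions, with the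
junk value `0` if the weight `w` is not integrable. -/
def average (hW : IsContinuousInMeasure ν W) (w : Y → ℝ) : C(Y, 𝕜) →L[𝕜] C(X, 𝕜) :=
  if hw : Integrable w ν then
    LinearMap.mkContinuous
      { toFun := fun h => ⟨fun x => ∫ y in W x, w y • h y ∂ν,
          hW.continuous_setIntegral (integrable_smul_continuousMap hw h)⟩
        map_add' := fun h₁ h₂ => ContinuousMap.ext fun x => by
          simpa using integral_add (μ := ν.restrict (W x))
            (integrable_smul_continuousMap hw h₁).restrict
            (integrable_smul_continuousMap hw h₂).restrict
        map_smul' := fun a h => ContinuousMap.ext fun x => by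
          simpa using integral_const_mul a fun y => w y • h y }
      (∫ y, ‖w y‖ ∂ν) fun h => by
        refine (ContinuousMap.norm_le _ (by positivity)).2 fun x =>
          (norm_setIntegral_smul_le hw h (W x)).trans <|
            mul_le_mul_of_nonneg_right ?_ (norm_nonneg h)
        exact setIntegral_le_integral hw.norm (.of_forall fun y => norm_nonneg _)
  else 0

variable {𝕜} (hW : IsContinuousInMeasure ν W)

theorem average_apply (hw : Integrable w ν) (h : C(Y, 𝕜)) (x : X) :
    hW.average 𝕜 w h x = ∫ y in W x, w y • h y ∂ν := by
  rw [average, dif_pos hw]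
  rfl

variable (𝕜) in
theorem norm_average_le (hw : Integrable w ν) : ‖hW.average 𝕜 w‖ ≤ ∫ y, ‖w y‖ ∂ν := by
  rw [average, dif_pos hw]
  exact LinearMap.mkContinuous_norm_le _ (by positivity) _

variable (𝕜) in
theorem average_sub (hw : Integrable w ν) (hw' : Integrable w' ν) :
    hW.average 𝕜 (w - w') = hW.average 𝕜 w - hW.average 𝕜 w' := by
  ext h x
  simp only [sub_apply, ContinuousMap.sub_apply,
    average_apply, hw, hw', hw.sub hw', Pi.sub_apply, sub_smul]
  exact integral_sub (integrable_smul_continuousMap hw h).restrict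
    (integrable_smul_continuousMap hw' h).restrict

theorem equicontinuous_average_image_ball (hw : Integrable w ν) :
    Equicontinuous ((↑) : hW.average 𝕜 w '' Metric.ball 0 1 → X → 𝕜) := fun x => by
  refine Metric.equicontinuousAt_of_continuity_modulus _
    (hW.tendsto_setIntegral_symmDiff hw.norm x) _ (.of_forall fun x' => ?_)
  rintro ⟨_, h, hh, rfl⟩
  have hh1 : ‖h‖ ≤ 1 := (mem_ball_zero_iff.1 hh).le
  have hint := integrable_smul_continuousMap hw h
  calc dist (hW.average 𝕜 w h x) (hW.average 𝕜 w h x')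
      = ‖∫ y in W x', w y • h y ∂ν - ∫ y in W x, w y • h y ∂ν‖ := by
        rw [dist_comm, dist_eq_norm, hW.average_apply hw, hW.average_apply hw]
    _ ≤ ∫ y in W x' ∆ W x, ‖w y • h y‖ ∂ν :=
        norm_setIntegral_sub_setIntegral_le hint (hW.measurableSet _) (hW.measurableSet _)
    _ ≤ ∫ y in W x' ∆ W x, ‖w y‖ ∂ν := by
        refine integral_mono hint.norm.restrict hw.norm.restrict fun y => ?_
        simp only [norm_smul]
        exact mul_le_of_le_one_right (norm_nonneg _) ((h.norm_coe_le_norm y).trans hh1)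

variable (𝕜) in
theorem isCompactOperator_average (hw : Integrable w ν) :
    IsCompactOperator (hW.average 𝕜 w) := by
  set T := hW.average 𝕜 w
  have hbound : ∀ f ∈ T '' Metric.ball 0 1, ∀ x, f x ∈ Metric.closedBall (0 : 𝕜) ‖T‖ := by
    rintro _ ⟨h, hh, rfl⟩ x
    exact mem_closedBall_zero_iff.2 (((T h).norm_coe_le_norm x).trans
      (T.unit_le_opNorm h (mem_ball_zero_iff.1 hh).le))
  exact (isCompactOperator_iff_isCompact_closure_image_ball (T : C(Y, 𝕜) →ₗ[𝕜] C(X, 𝕜))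
    one_pos).2 (isCompact_closure_of_equicontinuous (isCompact_closedBall _ _) hbound
      (hW.equicontinuous_average_image_ball hw))

end IsContinuousInMeasure

theorem integral_bind_kernel {α β G : Type*} [MeasurableSpace α] [MeasurableSpace β]
    [NormedAddCommGroup G] [NormedSpace ℝ G] {m : Measure α} {κ : Kernel α β} {f : β → G}
    (hf : Integrable f (m.bind κ)) : ∫ y, f y ∂(m.bind κ) = ∫ x, ∫ y, f y ∂κ x ∂m := by
  rw [Measure.comp_eq_comp_const_apply] at hf ⊢
  rw [Kernel.integral_comp hf, Kernel.const_apply]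

theorem IsContinuousInMeasure.integral_average {Y 𝕜 : Type*} [RCLike 𝕜] [TopologicalSpace Y]
    [CompactSpace Y] [MeasurableSpace Y] [OpensMeasurableSpace Y] {ν μ : Measure Y}
    [IsFiniteMeasure ν] [IsProbabilityMeasure μ] {W : Y → Set Y} {hW : IsContinuousInMeasure ν W}
    (hμ : hW.kernel.Invariant μ) {w : Y → ℝ} (hw : Integrable w ν) (h : C(Y, 𝕜)) :
    ∫ x, hW.average 𝕜 w h x ∂μ = ∫ y, w y • h y ∂μ := by
  have hint : Integrable (fun y => w y • h y) (μ.bind hW.kernel) := by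
    rw [hμ.def]
    exact (integrable_smul_continuousMap hw h).mono_measure (le_of_invariant_kernel hμ)
  simp_rw [hW.average_apply hw]
  conv_rhs => rw [← hμ.def, integral_bind_kernel hint]
  rfl

end Averages

section LeadingEigenvalue

variable {Y : Type*} [TopologicalSpace Y] [CompactSpace Y] {T : C(Y, ℂ) →L[ℂ] C(Y, ℂ)}
  {u : C(Y, ℂ)} {z : ℝ}

theorem norm_eigenvalue_le_of_dominated (hu : ∀ x, u x ≠ 0)
    (hdom : ∀ v : C(Y, ℂ), (∀ x, ‖v x‖ ≤ ‖u x‖) → ∀ x, ‖T v x‖ ≤ z * ‖u x‖)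
    {ζ : ℂ} {v : C(Y, ℂ)} (hv : v ≠ 0) (hTv : T v = ζ • v) : ‖ζ‖ ≤ z := by
  obtain ⟨y, hy⟩ : ∃ y, v y ≠ 0 := DFunLike.ne_iff.1 hv
  obtain ⟨x, -, hx⟩ := isCompact_univ.exists_isMaxOn ⟨y, mem_univ y⟩
    (show Continuous fun x => ‖v x‖ / ‖u x‖ from
      v.continuous.norm.div u.continuous.norm fun x => norm_ne_zero_iff.2 (hu x)).continuousOn
  have hmax : ∀ x', ‖v x'‖ / ‖u x'‖ ≤ ‖v x‖ / ‖u x‖ := fun x' => hx (mem_univ x')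
  have hvx : 0 < ‖v x‖ / ‖u x‖ :=
    (div_pos (norm_pos_iff.2 hy) (norm_pos_iff.2 (hu y))).trans_le (hmax y)
  set t : ℝ := ‖v x‖ / ‖u x‖
  have hux : 0 < ‖u x‖ := norm_pos_iff.2 (hu x)
  have hscaled := hdom ((t⁻¹ : ℂ) • v) (fun x' => by
    have := (div_le_iff₀ (norm_pos_iff.2 (hu x'))).1 (hmax x')
    rwa [ContinuousMap.smul_apply, norm_smul, ← Complex.ofReal_inv, Complex.norm_real,
      norm_inv, Real.norm_of_nonneg hvx.le, inv_mul_le_iff₀ hvx]) x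
  have hvt : ‖v x‖ = t * ‖u x‖ := (div_mul_cancel₀ _ hux.ne').symm
  rw [map_smul, hTv, ContinuousMap.smul_apply, ContinuousMap.smul_apply, norm_smul, norm_smul,
    hvt, ← Complex.ofReal_inv, Complex.norm_real, norm_inv, Real.norm_of_nonneg hvx.le] at hscaled
  refine le_of_mul_le_mul_right ?_ hux
  calc ‖ζ‖ * ‖u x‖ = t⁻¹ * (‖ζ‖ * (t * ‖u x‖)) := by field_simp
    _ ≤ z * ‖u x‖ := hscaled

/-- `hdom` says that `z` bounds the operator norm of `T` with respect to `sup |v / u|`. -/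
theorem isLeadingEigenvalue_of_dominated [Nonempty Y] (hT : IsCompactOperator T)
    (hu : ∀ x, u x ≠ 0) (hTu : T u = (z : ℂ) • u)
    (hdom : ∀ v : C(Y, ℂ), (∀ x, ‖v x‖ ≤ ‖u x‖) → ∀ x, ‖T v x‖ ≤ z * ‖u x‖) :
    IsLeadingEigenvalue T z := by
  have hu0 : u ≠ 0 := DFunLike.ne_iff.2 ⟨Classical.arbitrary Y, hu _⟩
  have hz : ‖(z : ℂ)‖ ≤ z := norm_eigenvalue_le_of_dominated hu hdom hu0 hTu
  have hz0 : 0 ≤ z := (norm_nonneg _).trans hz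
  have heig : Module.End.HasEigenvalue (T : C(Y, ℂ) →ₗ[ℂ] C(Y, ℂ)) (z : ℂ) :=
    Module.End.hasEigenvalue_of_hasEigenvector ⟨Module.End.mem_eigenspace_iff.2 hTu, hu0⟩
  refine ⟨heig, le_antisymm (iSup₂_le fun ζ hζ => ?_) ?_, hz0⟩
  · rcases eq_or_ne ζ 0 with rfl | hζ0
    · simp
    obtain ⟨v, hv⟩ := ((hT.hasEigenvalue_iff_mem_spectrum hζ0).2 hζ).exists_hasEigenvector
    rw [← enorm_eq_nnnorm, ← ofReal_norm]
    exact ENNReal.ofReal_le_ofReal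
      (norm_eigenvalue_le_of_dominated hu hdom hv.2 hv.apply_eq_smul)
  · have hmem : (z : ℂ) ∈ spectrum ℂ T := by
      rw [ContinuousLinearMap.spectrum_eq]
      exact heig.mem_spectrum
    calc ENNReal.ofReal z = ‖(z : ℂ)‖₊ := by
          rw [← enorm_eq_nnnorm, ← ofReal_norm, Complex.norm_of_nonneg hz0]
      _ ≤ spectralRadius ℂ T := le_iSup₂ (f := fun (k : ℂ) (_ : k ∈ spectrum ℂ T) =>
          (‖k‖₊ : ENNReal)) (z : ℂ) hmem

end LeadingEigenvalue

section InvariantMeasure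

variable {Y : Type*} [TopologicalSpace Y] [CompactSpace Y] [MeasurableSpace Y]

theorem norm_integral_continuousMap_le (m : Measure Y) [IsProbabilityMeasure m] (f : C(Y, ℝ)) :
    ‖∫ y, f y ∂m‖ ≤ ‖f‖ := by
  simpa using norm_integral_le_of_norm_le_const (μ := m) (.of_forall f.norm_coe_le_norm)

variable [OpensMeasurableSpace Y]

theorem integrable_continuousMap (m : Measure Y) [IsFiniteMeasure m] (f : C(Y, ℝ)) :
    Integrable f m :=
  f.continuous.integrable_of_hasCompactSupport (HasCompactSupport.of_compactSpace _)

/-- Integration against a probability measure, as a functional on continuous functions. -/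
def integralFunctional (m : Measure Y) [IsProbabilityMeasure m] : C(Y, ℝ) →L[ℝ] ℝ :=
  LinearMap.mkContinuous
    { toFun := fun f => ∫ y, f y ∂m
      map_add' := fun f₁ f₂ =>
        integral_add (integrable_continuousMap m f₁) (integrable_continuousMap m f₂)
      map_smul' := fun a _ => integral_const_mul a _ }
    1 fun f => (norm_integral_continuousMap_le m f).trans_eq (one_mul _).symm

theorem integralFunctional_apply (m : Measure Y) [IsProbabilityMeasure m] (f : C(Y, ℝ)) :
    integralFunctional m f = ∫ y, f y ∂m := rfl

variable {κ : Kernel Y Y} [IsMarkovKernel κ] {m : Measure Y} [IsProbabilityMeasure m]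

instance isProbabilityMeasure_iterate_bind (k : ℕ) :
    IsProbabilityMeasure ((fun m : Measure Y => m.bind κ)^[k] m) := by
  induction k with
  | zero => assumption
  | succ k ih =>
    rw [Function.iterate_succ_apply']
    exact inferInstanceAs (IsProbabilityMeasure (κ ∘ₘ _))

variable (κ m) in
/-- The Cesàro mean of the laws at times `0, …, N` of the Markov chain with kernel `κ` and initial
law `m`. -/
def cesaroMean (N : ℕ) : ProbabilityMeasure Y :=
  ⟨((N + 1 : ℕ) : ENNReal)⁻¹ •
    ∑ k ∈ Finset.range (N + 1), (fun m : Measure Y => m.bind κ)^[k] m, ⟨by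
      simp only [Measure.smul_apply, Measure.coe_finsetSum, Finset.sum_apply, measure_univ,
        Finset.sum_const, Finset.card_range, smul_eq_mul, nsmul_eq_mul, mul_one]
      exact ENNReal.inv_mul_cancel (by simp) (ENNReal.natCast_ne_top _)⟩⟩

variable {P : C(Y, ℝ) → C(Y, ℝ)}

theorem integral_bind_eq_integral_apply (hP : ∀ f x, P f x = ∫ y, f y ∂κ x) (f : C(Y, ℝ)) :
    ∫ y, f y ∂m.bind κ = ∫ y, P f y ∂m := by
  have : IsProbabilityMeasure (m.bind κ) := inferInstanceAs (IsProbabilityMeasure (κ ∘ₘ m))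
  simp_rw [hP]
  exact integral_bind_kernel (integrable_continuousMap _ f)

theorem integral_iterate_bind (hP : ∀ f x, P f x = ∫ y, f y ∂κ x) (k : ℕ) (f : C(Y, ℝ)) :
    ∫ y, f y ∂(fun m : Measure Y => m.bind κ)^[k] m = ∫ y, P^[k] f y ∂m := by
  induction k generalizing f with
  | zero => rfl
  | succ k ih =>
    rw [Function.iterate_succ_apply', integral_bind_eq_integral_apply hP, ih,
      Function.iterate_succ_apply]

theorem integral_cesaroMean (hP : ∀ f x, P f x = ∫ y, f y ∂κ x) (f : C(Y, ℝ)) (N : ℕ) :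
    ∫ y, f y ∂(cesaroMean κ m N : Measure Y) =
      birkhoffAverage ℝ P (fun f => ∫ y, f y ∂m) (N + 1) f := by
  rw [cesaroMean, ProbabilityMeasure.coe_mk, integral_smul_measure,
    integral_finsetSum_measure fun k _ => integrable_continuousMap _ f]
  simp only [integral_iterate_bind hP, ENNReal.toReal_inv, ENNReal.toReal_natCast,
    birkhoffAverage, birkhoffSum]

theorem tendsto_integral_cesaroMean_sub (hP : ∀ f x, P f x = ∫ y, f y ∂κ x) (f : C(Y, ℝ)) :
    Tendsto (fun N => ∫ y, P f y ∂(cesaroMean κ m N : Measure Y) -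
      ∫ y, f y ∂(cesaroMean κ m N : Measure Y)) atTop (𝓝 0) := by
  simp_rw [integral_cesaroMean hP]
  refine (tendsto_birkhoffAverage_apply_sub_birkhoffAverage ℝ ?_).comp (tendsto_add_atTop_nat 1)
  refine (Metric.isBounded_closedBall (x := (0 : ℝ)) (r := ‖f‖)).subset ?_
  rintro _ ⟨k, rfl⟩
  have hk : ‖∫ y, P^[k] f y ∂m‖ ≤ ‖f‖ := by
    rw [← integral_iterate_bind hP]
    exact norm_integral_continuousMap_le _ f
  exact mem_closedBall_zero_iff.2 hk

theorem integral_cesaroMean_of_fixed (hP : ∀ f x, P f x = ∫ y, f y ∂κ x) {h : C(Y, ℝ)}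
    (hh : P h = h) (N : ℕ) : ∫ y, h y ∂(cesaroMean κ m N : Measure Y) = ∫ y, h y ∂m := by
  rw [integral_cesaroMean hP]
  exact Function.IsFixedPt.birkhoffAverage_eq ℝ hh _ (Nat.cast_ne_zero.2 N.succ_ne_zero)

end InvariantMeasure

section KrylovBogoliubov

variable {Y : Type*} [MetricSpace Y] [CompactSpace Y] [MeasurableSpace Y] [BorelSpace Y]
  {κ : Kernel Y Y} [IsMarkovKernel κ]

/-- The limit `m` of the Cesàro means from the initial law `δ_{x₀}`, along an ultrafilter. -/
theorem exists_invariant_of_feller {P : C(Y, ℝ) → C(Y, ℝ)}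
    (hP : ∀ f x, P f x = ∫ y, f y ∂κ x) (x₀ : Y) :
    ∃ m : Measure Y, IsProbabilityMeasure m ∧ κ.Invariant m ∧
      ∀ h : C(Y, ℝ), P h = h → ∫ y, h y ∂m = h x₀ := by
  let A : ℕ → ProbabilityMeasure Y := cesaroMean κ (Measure.dirac x₀)
  let U : Ultrafilter ℕ := Ultrafilter.of atTop
  set m : ProbabilityMeasure Y := (U.map A).lim
  have hlim (f : C(Y, ℝ)) :
      Tendsto (fun N => ∫ y, f y ∂(A N : Measure Y)) U (𝓝 (∫ y, f y ∂(m : Measure Y))) :=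
    ProbabilityMeasure.tendsto_iff_forall_integral_tendsto.1
      (show Tendsto A U (𝓝 m) from (U.map A).le_nhds_lim)
      (BoundedContinuousFunction.mkOfCompact f)
  refine ⟨m, inferInstance, ?_, fun h hh => ?_⟩
  · have : IsProbabilityMeasure ((m : Measure Y).bind κ) :=
      inferInstanceAs (IsProbabilityMeasure (κ ∘ₘ (m : Measure Y)))
    refine ext_of_forall_integral_eq_of_IsFiniteMeasure fun f => ?_
    calc ∫ y, f y ∂((m : Measure Y).bind κ) = ∫ y, P f.toContinuousMap y ∂(m : Measure Y) :=
          integral_bind_eq_integral_apply hP f.toContinuousMap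
      _ = ∫ y, f y ∂(m : Measure Y) :=
          sub_eq_zero.1 <| tendsto_nhds_unique
            ((hlim (P f.toContinuousMap)).sub (hlim f.toContinuousMap))
            ((tendsto_integral_cesaroMean_sub hP _).mono_left (Ultrafilter.of_le _))
  · have hconst (N : ℕ) : ∫ y, h y ∂(A N : Measure Y) = h x₀ :=
      (integral_cesaroMean_of_fixed hP hh N).trans (integral_dirac _ _)
    exact tendsto_nhds_unique (hlim h) (by simp_rw [hconst]; exact tendsto_const_nhds)

theorem eq_zero_of_integral_eq_zero_of_uniquelyErgodic {P : C(Y, ℝ) → C(Y, ℝ)}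
    (hP : ∀ f x, P f x = ∫ y, f y ∂κ x) {μ : Measure Y}
    (huniq : ∀ m : Measure Y, IsProbabilityMeasure m → κ.Invariant m → m = μ) {h : C(Y, ℝ)}
    (hh : P h = h) (hμh : ∫ y, h y ∂μ = 0) : h = 0 := by
  ext x
  obtain ⟨m, hm, hinv, hmh⟩ := exists_invariant_of_feller hP x
  rw [← hmh h hh, huniq m hm hinv, hμh, ContinuousMap.zero_apply]

end KrylovBogoliubov

section ExponentialMoments

theorem isBigO_sub_taylor_one {𝕜 F : Type*} [NontriviallyNormedField 𝕜]
    [NormedAddCommGroup F] [NormedSpace 𝕜 F]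
    {f : 𝕜 → F} {x : 𝕜} (hf : AnalyticAt 𝕜 f x) :
    (fun t => f (x + t) - (f x + t • deriv f x)) =O[𝓝 0] fun t => ‖t‖ ^ 2 := by
  obtain ⟨p, hp⟩ := hf
  refine (hp.isBigO_sub_partialSum_pow 2).congr_left fun t => ?_
  have hcoeff : p.coeff 0 = f x := hp.coeff_zero _
  simp [FormalMultilinearSeries.partialSum, Finset.sum_range_succ, hcoeff, hp.deriv]

variable {Ω : Type*} [MeasurableSpace Ω] {ν : Measure Ω} {g : Ω → ℝ}

theorem zero_mem_interior_integrableExpSet_abs (hg : 0 ∈ interior (integrableExpSet g ν)) :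
    0 ∈ interior (integrableExpSet (fun y => |g y|) ν) := by
  rw [mem_interior_iff_mem_nhds] at hg ⊢
  have hneg : ∀ᶠ t in 𝓝 (0 : ℝ), -t ∈ integrableExpSet g ν :=
    (continuous_neg.tendsto' (0 : ℝ) 0 neg_zero).eventually hg
  filter_upwards [hg, hneg] with t ht ht'
  exact integrable_exp_mul_abs ht ht'

theorem isBigO_mgf_sub [IsProbabilityMeasure ν] (hg : 0 ∈ interior (integrableExpSet g ν)) :
    (fun θ => mgf g ν θ - (1 + θ * ∫ y, g y ∂ν)) =O[𝓝 0] fun θ => θ ^ 2 := by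
  simpa [deriv_mgf_zero hg] using isBigO_sub_taylor_one (analyticAt_mgf hg)

theorem abs_exp_sub_one_le_exp_abs_sub_one (x : ℝ) : |Real.exp x - 1| ≤ Real.exp |x| - 1 := by
  have hcosh : 1 ≤ (Real.exp x + Real.exp (-x)) / 2 := Real.cosh_eq x ▸ Real.one_le_cosh x
  rcases le_total 0 x with hx | hx
  · rw [abs_of_nonneg hx, abs_of_nonneg (sub_nonneg.2 (Real.one_le_exp hx))]
  · rw [abs_of_nonpos hx, abs_of_nonpos (sub_nonpos.2 (Real.exp_le_one_iff.2 hx))]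
    linarith

theorem isBigO_integral_norm_exp_mul_sub_one (hg : 0 ∈ interior (integrableExpSet g ν)) :
    (fun θ => ∫ y, ‖Real.exp (θ * g y) - 1‖ ∂ν) =O[𝓝 0] fun θ => θ := by
  have habs := zero_mem_interior_integrableExpSet_abs hg
  have hone : Integrable (fun _ => (1 : ℝ)) ν := by
    simpa using integrable_of_mem_integrableExpSet (interior_subset hg)
  have hnorm : Tendsto (fun θ : ℝ => |θ|) (𝓝 0) (𝓝 0) := continuous_abs.tendsto' 0 0 abs_zero
  have hmgf := ((differentiableAt_mgf habs).isBigO_sub).comp_tendsto hnorm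
  refine (IsBigO.of_norm_eventuallyLE ?_).trans (hmgf.trans ?_)
  swap
  · simpa [Function.comp_def] using (isBigO_refl (fun θ : ℝ => θ) (𝓝 0)).norm_left
  filter_upwards [hnorm.eventually (mem_interior_iff_mem_nhds.1 habs)] with θ hθ
  have hexp : Integrable (fun y => Real.exp (|θ| * |g y|)) ν := hθ
  rw [Real.norm_of_nonneg (by positivity)]
  calc ∫ y, ‖Real.exp (θ * g y) - 1‖ ∂ν ≤ ∫ y, (Real.exp (|θ| * |g y|) - 1) ∂ν := by
        refine integral_mono_of_nonneg (.of_forall fun y => norm_nonneg _) (hexp.sub hone)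
          (.of_forall fun y => ?_)
        simp only [Real.norm_eq_abs, ← abs_mul]
        exact abs_exp_sub_one_le_exp_abs_sub_one _
    _ = mgf (fun y => |g y|) ν |θ| - mgf (fun y => |g y|) ν 0 := by
        rw [integral_sub hexp hone]
        simp [mgf]

end ExponentialMoments

section Expansion

namespace IsContinuousInMeasure

section PositiveEigenfunction

variable {Y : Type*} [TopologicalSpace Y] [CompactSpace Y] [MeasurableSpace Y]
  [OpensMeasurableSpace Y] {ν : Measure Y} {W : Y → Set Y} (hW : IsContinuousInMeasure ν W)

theorem isLeadingEigenvalue_average [Nonempty Y] {w : Y → ℝ} (hw : Integrable w ν)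
    (hw0 : ∀ y, 0 ≤ w y) {h : C(Y, ℝ)} (hpos : ∀ y, 0 < h y) {z : ℝ}
    (hz : hW.average ℝ w h = z • h) : IsLeadingEigenvalue (hW.average ℂ w) z := by
  have hzx (x : Y) : ∫ y in W x, w y * h y ∂ν = z * h x := by
    simpa [hW.average_apply hw] using DFunLike.congr_fun hz x
  let u : C(Y, ℂ) := ⟨fun x => (h x : ℂ), by fun_prop⟩
  have hnorm (x : Y) : ‖u x‖ = h x := Complex.norm_of_nonneg (hpos x).le
  refine isLeadingEigenvalue_of_dominated (u := u) (hW.isCompactOperator_average ℂ hw)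
    (fun x => Complex.ofReal_ne_zero.2 (hpos x).ne') ?_ fun v hv x => ?_
  · ext x
    calc hW.average ℂ w u x = ∫ y in W x, ((w y * h y : ℝ) : ℂ) ∂ν := by
          simp [hW.average_apply hw, u]
      _ = ((z : ℂ) • u) x := by
          rw [integral_complex_ofReal, hzx]
          simp [u]
  · calc ‖hW.average ℂ w v x‖ ≤ ∫ y in W x, ‖w y • v y‖ ∂ν := by
          rw [hW.average_apply hw]
          exact norm_integral_le_integral_norm _
      _ ≤ ∫ y in W x, w y * h y ∂ν := by
          refine integral_mono (integrable_smul_continuousMap hw v).norm.restrict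
            (integrable_smul_continuousMap hw h).restrict fun y => ?_
          simp only [norm_smul, Real.norm_of_nonneg (hw0 y)]
          exact mul_le_mul_of_nonneg_left (hnorm y ▸ hv y) (hw0 y)
      _ = z * ‖u x‖ := by rw [hzx, hnorm]

end PositiveEigenfunction

section UniquelyErgodic

variable {Y : Type*} [MetricSpace Y] [CompactSpace Y] [MeasurableSpace Y] [BorelSpace Y]
  {ν μ : Measure Y} [IsFiniteMeasure ν] [IsProbabilityMeasure μ] {W : Y → Set Y}
  {hW : IsContinuousInMeasure ν W}

theorem isSimpleEigentriple_average_one (hν : ∀ x, ν (W x) = 1) (hμ : hW.kernel.Invariant μ)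
    (huniq : ∀ m : Measure Y, IsProbabilityMeasure m → hW.kernel.Invariant m → m = μ) :
    IsSimpleEigentriple (hW.average ℝ 1) 1 1 (integralFunctional μ) := by
  have hone : Integrable (1 : Y → ℝ) ν := integrable_const 1
  have : IsMarkovKernel hW.kernel := ⟨fun x => ⟨by simp [hW.kernel_apply, hν]⟩⟩
  have hP (f : C(Y, ℝ)) (x : Y) : hW.average ℝ 1 f x = ∫ y, f y ∂hW.kernel x := by
    simp [hW.average_apply hone, hW.kernel_apply]
  refine isSimpleEigentriple_of_isCompactOperator (hW.isCompactOperator_average ℝ hone)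
    one_ne_zero ?_ (fun f => ?_) ?_ fun f hf hμf => ?_
  · ext x
    simp [hP]
  · simp [integralFunctional_apply, integral_average hμ hone f]
  · simp [integralFunctional_apply]
  · exact eq_zero_of_integral_eq_zero_of_uniquelyErgodic hP huniq (by rwa [one_smul] at hf) hμf

theorem isBigO_average_exp_sub {g : Y → ℝ} (hg : 0 ∈ interior (integrableExpSet g ν)) :
    (fun θ => hW.average ℝ (fun y => Real.exp (θ * g y)) - hW.average ℝ 1) =O[𝓝 0]
      fun θ : ℝ => θ := by
  have hone : Integrable (1 : Y → ℝ) ν := integrable_const 1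
  refine (IsBigO.of_norm_eventuallyLE ?_).trans (isBigO_integral_norm_exp_mul_sub_one hg)
  filter_upwards [mem_interior_iff_mem_nhds.1 hg] with θ hθ
  rw [← hW.average_sub ℝ hθ hone]
  exact hW.norm_average_le ℝ (hθ.sub hone)

theorem integralFunctional_average_exp_sub_one (hμ : hW.kernel.Invariant μ) {g : Y → ℝ} {θ : ℝ}
    (hθ : θ ∈ integrableExpSet g ν) :
    integralFunctional μ ((hW.average ℝ (fun y => Real.exp (θ * g y)) - hW.average ℝ 1) 1) =
      mgf g μ θ - 1 := by
  have hone : Integrable (1 : Y → ℝ) ν := integrable_const 1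
  rw [sub_apply, map_sub]
  simp [integralFunctional_apply, integral_average hμ hθ, integral_average hμ hone, mgf]

theorem exists_isLeadingEigenvalue_average_exp [Nonempty Y] (hν : ∀ x, ν (W x) = 1)
    (hμ : hW.kernel.Invariant μ)
    (huniq : ∀ m : Measure Y, IsProbabilityMeasure m → hW.kernel.Invariant m → m = μ)
    {g : Y → ℝ} (hg : 0 ∈ interior (integrableExpSet g ν)) :
    ∃ r : ℝ → ℝ,
      (∀ᶠ θ in 𝓝 0, IsLeadingEigenvalue (hW.average ℂ fun y => Real.exp (θ * g y)) (r θ)) ∧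
      (fun θ => r θ - (1 + θ * ∫ y, g y ∂μ)) =O[𝓝 0] fun θ => θ ^ 2 := by
  obtain ⟨z, h, heig, hlim, hz⟩ :=
    (isSimpleEigentriple_average_one hν hμ huniq).exists_perturbation
  set T : ℝ → C(Y, ℝ) →L[ℝ] C(Y, ℝ) := fun θ => hW.average ℝ fun y => Real.exp (θ * g y)
  have hTO : (fun θ => T θ - hW.average ℝ 1) =O[𝓝 0] fun θ : ℝ => θ := isBigO_average_exp_sub hg
  have hT : Tendsto T (𝓝 0) (𝓝 (hW.average ℝ 1)) :=
    (tendsto_iff_norm_sub_tendsto_zero (f := T)).2 (hTO.norm_left.trans_tendsto tendsto_id)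
  have hint : ∀ᶠ θ in 𝓝 0, θ ∈ integrableExpSet g ν := mem_interior_iff_mem_nhds.1 hg
  have hpos : ∀ᶠ θ in 𝓝 0, ∀ x, 0 < h (T θ) x := by
    have hopen := ContinuousMap.isOpen_setOfPred_mapsTo (Y := ℝ) (isCompact_univ (X := Y))
      (isOpen_Ioi (a := (0 : ℝ)))
    filter_upwards [(hlim.comp hT).eventually
      (hopen.mem_nhds fun x _ => mem_Ioi.2 one_pos)] with θ hθ x
    exact hθ (mem_univ x)
  refine ⟨fun θ => z (T θ), ?_, ?_⟩
  · filter_upwards [hT.eventually heig, hint, hpos] with θ hθ hθint hθpos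
    exact hW.isLeadingEigenvalue_average hθint (fun y => (Real.exp_pos _).le) hθpos hθ
  · have hgμ : 0 ∈ interior (integrableExpSet g μ) :=
      interior_mono (fun θ hθ => hθ.mono_measure (le_of_invariant_kernel hμ)) hg
    refine (((hz.comp_tendsto hT).trans (hTO.norm_left.pow 2)).add (isBigO_mgf_sub hgμ)).congr' ?_
      .rfl
    filter_upwards [hint] with θ hθ
    simp only [Function.comp_apply, T, integralFunctional_average_exp_sub_one hμ hθ]
    ring

end UniquelyErgodic

end IsContinuousInMeasure

end Expansion

namespace NoisyMap
namespace Component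

variable {n : ℕ} {S : NoisyMap n} (C : S.Component)

/-- Lebesgue measure on `Y`, normalized so that `x ↦ f x + w` turns uniform noise `w` into its
restriction to the translated cube. -/
def reference : Measure C.Y :=
  (volume (cube n S.σ))⁻¹ • (volume : Measure (EuclideanSpace ℝ (Fin n))).comap Subtype.val

/-- The points of `Y` that can be reached from `x` in one step. -/
def reachable (x : C.Y) : Set C.Y := {y | (y : EuclideanSpace ℝ (Fin n)) - S.f x ∈ cube n S.σ}

theorem measurableSet_Y : MeasurableSet C.Y := C.isCompact_Y.measurableSet

theorem inv_volume_cube_ne_top (S : NoisyMap n) : (volume (cube n S.σ))⁻¹ ≠ ⊤ := by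
  rw [volume_cube]
  exact ENNReal.inv_ne_top.2 (pow_ne_zero _ (by simpa using S.σ_pos))

theorem reference_apply (A : Set C.Y) :
    C.reference A = (volume (cube n S.σ))⁻¹ * volume (Subtype.val '' A) := by
  rw [reference, Measure.smul_apply, comap_subtype_coe_apply C.measurableSet_Y, smul_eq_mul]

instance : IsFiniteMeasure C.reference := ⟨by
  rw [C.reference_apply, image_univ, Subtype.range_coe]
  exact ENNReal.mul_lt_top (inv_volume_cube_ne_top S).lt_top C.isCompact_Y.measure_lt_top⟩

theorem reference_preimage_le (N : Set (EuclideanSpace ℝ (Fin n))) :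
    C.reference (Subtype.val ⁻¹' N) ≤ (volume (cube n S.σ))⁻¹ * volume N := by
  rw [C.reference_apply]
  gcongr
  exact image_preimage_subset _ _

theorem continuous_f : Continuous fun x : C.Y => S.f x :=
  (S.continuousOn_f.mono C.subset_X).domRestrict

theorem isContinuousInMeasure : IsContinuousInMeasure C.reference C.reachable where
  measurableSet x := (measurableSet_cube n S.σ).preimage (by fun_prop)
  tendsto_symmDiff x := by
    let τ : C(EuclideanSpace ℝ (Fin n) × EuclideanSpace ℝ (Fin n), EuclideanSpace ℝ (Fin n)) :=
      ⟨fun p => p.2 - p.1, by fun_prop⟩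
    let W (x' : C.Y) := τ.curry (S.f x') ⁻¹' cube n S.σ
    have hvol : Tendsto (fun x' => volume (W x' ∆ W x)) (𝓝 x) (𝓝 0) := by
      refine tendsto_measure_symmDiff_preimage_nhds_zero
        ((τ.curry.continuous.comp C.continuous_f).tendsto x)
        (.of_forall fun x' => measurePreserving_sub_right volume (S.f x'))
        (measurePreserving_sub_right volume (S.f x))
        (measurableSet_cube n S.σ).nullMeasurableSet ?_
      rw [volume_cube]
      exact ENNReal.pow_ne_top ENNReal.ofReal_ne_top
    refine tendsto_of_tendsto_of_tendsto_of_le_of_le tendsto_const_nhds ?_ (fun _ => zero_le)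
      (fun x' => C.reference_preimage_le (W x' ∆ W x))
    simpa using ENNReal.Tendsto.const_mul hvol (.inr (inv_volume_cube_ne_top S))

theorem measurable_step (x : C.Y) : Measurable fun ω : S.Ω => C.step ω x :=
  Measurable.subtype_mk ((measurable_subtype_coe.comp (measurable_pi_apply 0)).const_add _)

theorem map_step (x : C.Y) :
    S.ℙ.map (fun ω => C.step ω x) = C.reference.restrict (C.reachable x) := by
  ext A hA
  let φ : cube n S.σ → C.Y := fun w => ⟨S.f x + w, C.add_mem x x.2 _ w.2⟩
  have hφ : Measurable φ := Measurable.subtype_mk (measurable_subtype_coe.const_add _)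
  have himage : Subtype.val '' (φ ⁻¹' A) =
      (S.f x + ·) ⁻¹' (Subtype.val '' (A ∩ C.reachable x)) := by
    ext w
    constructor
    · rintro ⟨w, hw, rfl⟩
      exact ⟨φ w, ⟨hw, by simp [reachable, φ]⟩, rfl⟩
    · rintro ⟨y, ⟨hyA, hyW⟩, hy⟩
      have hw : w = y - S.f x := by simp [hy]
      have hφw : φ ⟨w, hw ▸ hyW⟩ = y := Subtype.ext hy.symm
      exact ⟨⟨w, hw ▸ hyW⟩, by rwa [mem_preimage, hφw], rfl⟩
  calc S.ℙ.map (fun ω => C.step ω x) A = noise n S.σ (φ ⁻¹' A) := by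
        rw [Measure.map_apply (C.measurable_step x) hA]
        exact (measurePreserving_eval_infinitePi (fun _ : ℕ => noise n S.σ) 0).measure_preimage
          (hφ hA).nullMeasurableSet
    _ = C.reference.restrict (C.reachable x) A := by
        rw [noise, Measure.smul_apply, comap_subtype_coe_apply (measurableSet_cube n S.σ), himage,
          measure_preimage_add, smul_eq_mul, ← C.reference_apply, Measure.restrict_apply hA]

instance : IsProbabilityMeasure S.ℙ :=
  inferInstanceAs (IsProbabilityMeasure (Measure.infinitePi fun _ : ℕ => noise n S.σ))

theorem reference_reachable (x : C.Y) : C.reference (C.reachable x) = 1 := by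
  rw [← Measure.restrict_apply_univ, ← C.map_step x,
    Measure.map_apply (C.measurable_step x) MeasurableSet.univ, preimage_univ, measure_univ]

theorem isStationary_iff {μ : Measure C.Y} :
    C.IsStationary μ ↔ C.isContinuousInMeasure.kernel.Invariant μ := by
  set κ := C.isContinuousInMeasure.kernel
  have hstep (A : Set C.Y) (hA : MeasurableSet A) (x : C.Y) :
      S.ℙ {ω | C.step ω x ∈ A} = κ x A := by
    rw [IsContinuousInMeasure.kernel_apply, ← C.map_step x,
      Measure.map_apply (C.measurable_step x) hA]
    rfl
  have hbind (A : Set C.Y) (hA : MeasurableSet A) :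
      μ.bind κ A = ∫⁻ x, S.ℙ {ω | C.step ω x ∈ A} ∂μ := by
    simp_rw [Measure.bind_apply hA κ.aemeasurable, hstep A hA]
  rw [Kernel.Invariant, Measure.ext_iff]
  exact forall₂_congr fun A hA => by rw [hbind A hA, eq_comm]

theorem isTwistedTransferOperator_average {θ : ℝ}
    (hθ : θ ∈ integrableExpSet (fun y : C.Y => S.g y) C.reference) :
    C.IsTwistedTransferOperator θ
      (C.isContinuousInMeasure.average ℂ fun y => Real.exp (θ * S.g y)) where
  integrable x := by
    refine Integrable.comp_measurable (g := fun y : C.Y => Real.exp (θ * S.g y)) ?_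
      (C.measurable_step x)
    rw [C.map_step]
    exact hθ.restrict
  apply_eq h x := by
    have hint := (integrable_smul_continuousMap hθ h).restrict (s := C.reachable x)
    rw [IsContinuousInMeasure.average_apply _ hθ, ← C.map_step,
      integral_map (C.measurable_step x).aemeasurable]
    · simp only [Complex.real_smul]
    · rw [C.map_step]
      exact hint.aestronglyMeasurable

end Component
end NoisyMap

section MinkowskiCodimension

/-- The set `A` has Minkowski codimension at least `s` with respect to `ν`, in the sense that its
`r`-neighbourhood has measure `O(r ^ s)` as `r → 0⁺`. -/
def HasMinkowskiCodim {E : Type*} [PseudoEMetricSpace E] [MeasurableSpace E] (ν : Measure E)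
    (A : Set E) (s : ℝ) : Prop :=
  ∃ c : ℝ, ∀ᶠ r in 𝓝[>] 0, ν (Metric.thickening r A) ≤ ENNReal.ofReal (c * r ^ s)

namespace HasMinkowskiCodim

section EMetric

variable {E : Type*} [PseudoEMetricSpace E] [MeasurableSpace E] {ν : Measure E} {s : ℝ}

theorem mono {A B : Set E} (hB : HasMinkowskiCodim ν B s) (hAB : A ⊆ B) :
    HasMinkowskiCodim ν A s :=
  hB.imp fun _ hc => hc.mono fun r hr =>
    (measure_mono (Metric.thickening_subset_of_subset r hAB)).trans hr

theorem iUnion {ι : Type*} [Finite ι] {A : ι → Set E} (hA : ∀ i, HasMinkowskiCodim ν (A i) s) :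
    HasMinkowskiCodim ν (⋃ i, A i) s := by
  cases nonempty_fintype ι
  choose c hc using hA
  refine ⟨∑ i, |c i|, ?_⟩
  filter_upwards [eventually_all.2 hc, self_mem_nhdsWithin] with r hr (hr0 : 0 < r)
  rw [Metric.thickening_iUnion, Finset.sum_mul,
    ENNReal.ofReal_sum_of_nonneg fun i _ => by positivity]
  refine (measure_iUnion_fintype_le _ _).trans (Finset.sum_le_sum fun i _ => (hr i).trans ?_)
  gcongr
  exact le_abs_self _

theorem measure_closure {A : Set E} (hA : HasMinkowskiCodim ν A s) (hs : 0 < s) :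
    ν (closure A) = 0 := by
  obtain ⟨c, hc⟩ := hA
  have hlim : Tendsto (fun r : ℝ => ENNReal.ofReal (c * r ^ s)) (𝓝[>] 0) (𝓝 0) := by
    have hpow : Continuous fun r : ℝ => ENNReal.ofReal (c * r ^ s) :=
      ENNReal.continuous_ofReal.comp
        (continuous_const.mul (Real.continuous_rpow_const hs.le))
    exact (hpow.tendsto' 0 0 (by simp [Real.zero_rpow hs.ne'])).mono_left nhdsWithin_le_nhds
  refine le_antisymm (ge_of_tendsto hlim ?_) zero_le
  filter_upwards [hc, self_mem_nhdsWithin] with r hr hr0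
  exact (measure_mono (Metric.closure_subset_thickening hr0 A)).trans hr

end EMetric

/-- A mass distribution principle: each point of the `r`-neighbourhood of `A` carries a ball of
radius `2 r` that is large for `ρ`, while `ρ ⊗ ν {dist < 2 r} = ∫ ν (ball x (2 r)) dρ(x)` is
small. -/
theorem of_le_measure_ball {E : Type*} [PseudoMetricSpace E] [SecondCountableTopology E]
    [MeasurableSpace E] [OpensMeasurableSpace E] {ν ρ : Measure E} [SFinite ν]
    [IsFiniteMeasure ρ] {A : Set E} {a b p q : ℝ} (ha : 0 < a)
    (hρ : ∀ᶠ r in 𝓝[>] 0, ∀ x ∈ A, ENNReal.ofReal (a * r ^ p) ≤ ρ (Metric.ball x r))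
    (hν : ∀ x, ∀ r > 0, ν (Metric.ball x r) ≤ ENNReal.ofReal (b * r ^ q)) :
    HasMinkowskiCodim ν A (q - p) := by
  refine ⟨b * 2 ^ q * ρ.real univ / a, ?_⟩
  filter_upwards [hρ, self_mem_nhdsWithin] with r hr (hr0 : 0 < r)
  have hpos : 0 < a * r ^ p := by positivity
  have hs : MeasurableSet {z : E × E | dist z.1 z.2 < 2 * r} :=
    (isOpen_lt continuous_dist continuous_const).measurableSet
  have hlarge : ∀ y ∈ Metric.thickening r A,
      ENNReal.ofReal (a * r ^ p) ≤ ρ (Metric.ball y (2 * r)) := fun y hy => by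
    obtain ⟨x, hx, hyx⟩ := Metric.mem_thickening_iff.1 hy
    refine (hr x hx).trans (measure_mono (Metric.ball_subset_ball' ?_))
    rw [dist_comm]
    linarith
  have hmul : ENNReal.ofReal (a * r ^ p) * ν (Metric.thickening r A) ≤
      ENNReal.ofReal (b * (2 * r) ^ q) * ρ univ :=
    calc ENNReal.ofReal (a * r ^ p) * ν (Metric.thickening r A)
        ≤ ∫⁻ y, ρ (Metric.ball y (2 * r)) ∂ν := by
          rw [← setLIntegral_const]
          exact (setLIntegral_mono' Metric.isOpen_thickening.measurableSet hlarge).trans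
            (setLIntegral_le_lintegral _ _)
      _ = ∫⁻ x, ν (Prod.mk x ⁻¹' {z : E × E | dist z.1 z.2 < 2 * r}) ∂ρ := by
          rw [← Measure.prod_apply hs, Measure.prod_apply_symm hs]
          rfl
      _ ≤ ∫⁻ _, ENNReal.ofReal (b * (2 * r) ^ q) ∂ρ := by
          refine lintegral_mono fun x => (measure_mono fun y hy => ?_).trans
            (hν x (2 * r) (by positivity))
          rwa [Metric.mem_ball, dist_comm]
      _ = ENNReal.ofReal (b * (2 * r) ^ q) * ρ univ := lintegral_const _
  calc ν (Metric.thickening r A)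
      ≤ ENNReal.ofReal (b * (2 * r) ^ q) * ρ univ / ENNReal.ofReal (a * r ^ p) :=
        (ENNReal.le_div_iff_mul_le (by simp [hpos]) (by simp)).2 (by rwa [mul_comm])
    _ = ENNReal.ofReal (b * 2 ^ q * ρ.real univ / a * r ^ (q - p)) := by
        rw [← ofReal_measureReal, ← ENNReal.ofReal_mul' measureReal_nonneg,
          ← ENNReal.ofReal_div_of_pos hpos, Real.mul_rpow zero_le_two hr0.le, Real.rpow_sub hr0]
        congr 1
        field_simp

end HasMinkowskiCodim

section NormedSpace

variable {F E : Type*} [NormedAddCommGroup F] [NormedSpace ℝ F] [FiniteDimensional ℝ F]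
  [MeasurableSpace F] [BorelSpace F] {m : Measure F} [m.IsAddHaarMeasure]

theorem le_addHaar_inter_closedBall_of_convex {K : Set F} (hK : Convex ℝ K)
    (hbdd : Bornology.IsBounded K) {t : F} (ht : t ∈ K) {δ : ℝ} (hδ : δ ∈ Icc 0 1) :
    ENNReal.ofReal (δ ^ Module.finrank ℝ F) * m K ≤
      m (K ∩ Metric.closedBall t (δ * Metric.diam K)) := by
  have hnonneg : 0 ≤ δ ^ Module.finrank ℝ F := pow_nonneg hδ.1 _
  rw [← abs_of_nonneg hnonneg, ← Measure.addHaar_image_homothety m t]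
  refine measure_mono ?_
  rintro _ ⟨x, hx, rfl⟩
  refine ⟨?_, ?_⟩
  · rw [AffineMap.homothety_eq_lineMap]
    exact hK.lineMap_mem ht hx hδ
  · rw [Metric.mem_closedBall, dist_homothety_center, Real.norm_of_nonneg hδ.1]
    exact mul_le_mul_of_nonneg_left (Metric.dist_le_diam_of_mem hbdd ht hx) hδ.1

theorem HasMinkowskiCodim.image_of_convex [NormedAddCommGroup E] [NormedSpace ℝ E]
    [FiniteDimensional ℝ E] [MeasurableSpace E] [BorelSpace E] {ν : Measure E}
    [ν.IsAddHaarMeasure] {K : Set F} (hK : IsCompact K) (hconv : Convex ℝ K)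
    (hm : m K ≠ 0) {φ : F → E} {L : NNReal} (hφ : LipschitzOnWith L φ K) :
    HasMinkowskiCodim ν (φ '' K) (Module.finrank ℝ E - Module.finrank ℝ F) := by
  have hφm : AEMeasurable φ (m.restrict K) := hφ.continuousOn.aemeasurable hK.measurableSet
  have : IsFiniteMeasure (m.restrict K) := isFiniteMeasure_restrict.2 hK.measure_ne_top
  set M : ℝ := L * Metric.diam K + 1
  have hM : 0 < M := by positivity
  refine of_le_measure_ball (ρ := (m.restrict K).map φ) (b := ν.real (Metric.ball 0 1))
    (a := m.real K / M ^ Module.finrank ℝ F) ?_ ?_ fun x r hr => ?_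
  · exact div_pos (ENNReal.toReal_pos hm hK.measure_ne_top) (by positivity)
  · filter_upwards [Ioo_mem_nhdsGT hM] with r hr
    rintro _ ⟨t, ht, rfl⟩
    have hδ : r / M ∈ Icc 0 1 := ⟨by have := hr.1; positivity, (div_le_one hM).2 hr.2.le⟩
    have hball : K ∩ Metric.closedBall t (r / M * Metric.diam K) ⊆
        φ ⁻¹' Metric.ball (φ t) r ∩ K := fun u ⟨huK, hu⟩ => by
      refine ⟨?_, huK⟩
      calc dist (φ u) (φ t) ≤ L * (r / M * Metric.diam K) :=
            (hφ.dist_le_mul u huK t ht).trans (by gcongr; exact hu)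
        _ = r * (L * Metric.diam K) / M := by ring
        _ < r := by
          rw [div_lt_iff₀ hM]
          exact mul_lt_mul_of_pos_left (lt_add_one _) hr.1
    calc ENNReal.ofReal (m.real K / M ^ Module.finrank ℝ F * r ^ (Module.finrank ℝ F : ℝ))
        = ENNReal.ofReal ((r / M) ^ Module.finrank ℝ F) * m K := by
          rw [← ofReal_measureReal hK.measure_ne_top, ← ENNReal.ofReal_mul' measureReal_nonneg,
            Real.rpow_natCast, div_pow]
          congr 1
          ring
      _ ≤ m (φ ⁻¹' Metric.ball (φ t) r ∩ K) :=
          (le_addHaar_inter_closedBall_of_convex hconv hK.isBounded ht hδ).trans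
            (measure_mono hball)
      _ = (m.restrict K).map φ (Metric.ball (φ t) r) := by
          rw [Measure.map_apply_of_aemeasurable hφm measurableSet_ball,
            Measure.restrict_apply' hK.measurableSet]
  · rw [Measure.addHaar_ball_of_pos ν x hr, Real.rpow_natCast, mul_comm,
      ENNReal.ofReal_mul measureReal_nonneg, ofReal_measureReal]

end NormedSpace

theorem integrable_rpow_neg_of_measure_lt_le {Ω : Type*} [MeasurableSpace Ω] {ν : Measure Ω}
    [IsFiniteMeasure ν] {d : Ω → ℝ} (hd : Measurable d) (hd0 : ∀ x, 0 ≤ d x) {c s t : ℝ}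
    (ht : 0 < t) (hts : t < s)
    (h : ∀ᶠ r in 𝓝[>] 0, ν {x | d x < r} ≤ ENNReal.ofReal (c * r ^ s)) :
    Integrable (fun x => d x ^ (-t)) ν := by
  have hlim : Tendsto (fun u : ℝ => u ^ (-t⁻¹)) atTop (𝓝[>] 0) :=
    tendsto_nhdsWithin_iff.2 ⟨tendsto_rpow_neg_atTop (inv_pos.2 ht),
      (eventually_gt_atTop 0).mono fun u hu => Real.rpow_pos_of_pos hu _⟩
  have htail : ∀ᶠ u in atTop, ν {x | u < d x ^ (-t)} ≤ ENNReal.ofReal (c * u ^ (-(s / t))) := by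
    filter_upwards [hlim.eventually h, eventually_gt_atTop 0] with u hu hu0
    have hpow : u ^ (-(s / t)) = (u ^ (-t⁻¹)) ^ s := by
      rw [← Real.rpow_mul hu0.le]
      congr 1
      ring
    rw [hpow]
    refine (measure_mono fun x (hx : u < d x ^ (-t)) => ?_).trans hu
    have hdx : 0 < d x := (hd0 x).lt_of_ne fun h0 => by
      rw [← h0, Real.zero_rpow (neg_ne_zero.2 ht.ne')] at hx
      exact hu0.not_gt hx
    rw [mem_ofPred_eq, ← inv_neg]
    exact (Real.lt_rpow_inv_iff_of_neg hdx hu0 (neg_neg_of_pos ht)).2 hx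
  obtain ⟨U, hU⟩ := eventually_atTop.1 (htail.and (eventually_gt_atTop 0))
  have hU0 : 0 < U := (hU U le_rfl).2
  refine ⟨(hd.pow_const _).aestronglyMeasurable, ?_⟩
  rw [hasFiniteIntegral_iff_ofReal (.of_forall fun x => Real.rpow_nonneg (hd0 x) _),
    lintegral_eq_lintegral_meas_lt ν (.of_forall fun x => Real.rpow_nonneg (hd0 x) _)
      (hd.pow_const _).aemeasurable, ← Ioc_union_Ioi_eq_Ioi hU0.le]
  refine (lintegral_union_le _ _ _).trans_lt (ENNReal.add_lt_top.2 ⟨?_, ?_⟩)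
  · calc ∫⁻ u in Ioc 0 U, ν {x | u < d x ^ (-t)} ≤ ∫⁻ _ in Ioc 0 U, ν univ :=
          lintegral_mono fun u => measure_mono (subset_univ _)
      _ < ⊤ := by simp [ENNReal.mul_lt_top, measure_lt_top]
  · calc ∫⁻ u in Ioi U, ν {x | u < d x ^ (-t)}
        ≤ ∫⁻ u in Ioi U, ENNReal.ofReal (c * u ^ (-(s / t))) :=
          setLIntegral_mono' measurableSet_Ioi fun u hu => (hU u (le_of_lt hu)).1
      _ < ⊤ := by
          have hst : -(s / t) < -1 := neg_lt_neg ((one_lt_div ht).2 hts)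
          exact ((integrableOn_Ioi_rpow_of_lt hst hU0).const_mul c).lintegral_lt_top

end MinkowskiCodimension

section ExponentialMomentsOfG

theorem abs_log_norm_inverse_le {V W : Type*} [NormedAddCommGroup V] [NormedSpace ℝ V]
    [NormedAddCommGroup W] [NormedSpace ℝ W] [Nontrivial W] {A : V →L[ℝ] W}
    (hA : A.IsInvertible) {q : ℝ} (hq : 0 < q) (hlow : ∀ v, ‖v‖ ≤ q * ‖A v‖)
    (hup : ∀ v, ‖A v‖ ≤ q * ‖v‖) : |Real.log ‖A.inverse‖| ≤ Real.log q := by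
  have hcomp : A ∘L A.inverse = .id ℝ W := by
    obtain ⟨e, rfl⟩ := hA
    ext w
    simp
  have hle : ‖A.inverse‖ ≤ q := ContinuousLinearMap.opNorm_le_bound _ hq.le fun w => by
    simpa [← ContinuousLinearMap.comp_apply, hcomp] using hlow (A.inverse w)
  have hge : q⁻¹ ≤ ‖A.inverse‖ := by
    rw [inv_le_iff_one_le_mul₀' hq]
    calc 1 = ‖A ∘L A.inverse‖ := by rw [hcomp, ContinuousLinearMap.norm_id]
      _ ≤ ‖A‖ * ‖A.inverse‖ := A.opNorm_comp_le _
      _ ≤ q * ‖A.inverse‖ := by gcongr; exact A.opNorm_le_bound hq.le hup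
  rw [abs_le, ← Real.log_inv]
  exact ⟨Real.log_le_log (inv_pos.2 hq) hge, Real.log_le_log ((inv_pos.2 hq).trans_le hge) hle⟩

section IntegrableExpSet

variable {α : Type*} [MeasurableSpace α] {ν : Measure α} {g : α → ℝ}

theorem zero_mem_interior_integrableExpSet (hg : AEStronglyMeasurable g ν) {a : ℝ} (ha : 0 < a)
    (hint : Integrable (fun y => Real.exp (a * |g y|)) ν) :
    0 ∈ interior (integrableExpSet g ν) := by
  rw [mem_interior_iff_mem_nhds]
  filter_upwards [Metric.closedBall_mem_nhds 0 ha] with θ hθ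
  rw [mem_closedBall_zero_iff, Real.norm_eq_abs] at hθ
  refine hint.mono' (Real.continuous_exp.comp_aestronglyMeasurable (hg.const_mul θ))
    (.of_forall fun y => ?_)
  rw [Real.norm_eq_abs, Real.abs_exp, Real.exp_le_exp]
  calc θ * g y ≤ |θ| * |g y| := by rw [← abs_mul]; exact le_abs_self _
    _ ≤ a * |g y| := by gcongr

theorem zero_mem_interior_integrableExpSet_of_le_log [IsFiniteMeasure ν]
    (hg : AEStronglyMeasurable g ν) {d : α → ℝ} (hd : Measurable d) (hd0 : ∀ x, 0 ≤ d x)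
    {c s : ℝ} (hs : 0 < s) (htail : ∀ᶠ r in 𝓝[>] 0, ν {x | d x < r} ≤ ENNReal.ofReal (c * r ^ s))
    {B β : ℝ} (hB : 0 < B) (hβ : 0 < β)
    (hle : ∀ᵐ x ∂ν, 0 < d x ∧ |g x| ≤ Real.log (B / d x ^ β)) :
    0 ∈ interior (integrableExpSet g ν) := by
  set a : ℝ := s / (2 * β)
  have haβ : a * β = s / 2 := by simp only [a]; field_simp
  refine zero_mem_interior_integrableExpSet hg (a := a) (by positivity) ?_
  have hint := (integrable_rpow_neg_of_measure_lt_le hd hd0 (half_pos hs) (half_lt_self hs)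
    htail).const_mul (B ^ a)
  refine hint.mono' (Real.continuous_exp.comp_aestronglyMeasurable (hg.norm.const_mul a)) ?_
  filter_upwards [hle] with x ⟨hdx, hgx⟩
  rw [Real.norm_eq_abs, Real.abs_exp]
  calc Real.exp (a * |g x|) ≤ Real.exp (Real.log (B / d x ^ β) * a) := by rw [mul_comm]; gcongr
    _ = (B / d x ^ β) ^ a := (Real.rpow_def_of_pos (by positivity) _).symm
    _ = B ^ a * d x ^ (-(s / 2)) := by
      rw [Real.div_rpow hB.le (by positivity), ← Real.rpow_mul hdx.le, mul_comm β, haβ,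
        Real.rpow_neg hdx.le, div_eq_mul_inv]

end IntegrableExpSet

namespace NoisyMap

variable {n : ℕ} {S : NoisyMap n}

theorem IsC1Holder.continuousOn_df (hf : S.IsC1Holder) : ContinuousOn S.df (S.X \ S.crit) := by
  obtain ⟨α, hα, hloc⟩ := hf
  intro x hx
  obtain ⟨K, r, hr, hK⟩ := hloc x hx
  have hlim : Tendsto (fun y => K * dist y x ^ α) (𝓝[S.X \ S.crit] x) (𝓝 0) := by
    have hcont : Continuous fun y => K * dist y x ^ α :=
      continuous_const.mul ((continuous_id.dist continuous_const).rpow_const fun _ => .inr hα.le)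
    exact (hcont.tendsto' x 0 (by simp [Real.zero_rpow hα.ne'])).mono_left nhdsWithin_le_nhds
  rw [ContinuousWithinAt, tendsto_iff_norm_sub_tendsto_zero]
  refine squeeze_zero' (.of_forall fun _ => norm_nonneg _) ?_ hlim
  filter_upwards [self_mem_nhdsWithin, nhdsWithin_le_nhds (Metric.ball_mem_nhds x hr)]
    with y hy hyr
  exact hK y hy x hx hyr (by simpa using hr)

theorem NondegenerateCrit.hasMinkowskiCodim (hn : 1 ≤ n) (hcrit : S.NondegenerateCrit) :
    HasMinkowskiCodim volume S.crit 1 := by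
  obtain ⟨N, φ, hφ, hcover⟩ := hcrit.exists_param
  refine (HasMinkowskiCodim.iUnion fun i => ?_).mono hcover
  obtain ⟨L, hL⟩ :=
    (hφ i).exists_lipschitzOnWith one_ne_zero (convex_Icc 0 1) isCompact_Icc
  have hIcc : volume (Icc (0 : Fin (n - 1) → ℝ) 1) ≠ 0 := by simp [Real.volume_Icc_pi]
  simpa [Nat.cast_sub hn] using
    HasMinkowskiCodim.image_of_convex (ν := (volume : Measure (EuclideanSpace ℝ (Fin n))))
      isCompact_Icc (convex_Icc 0 1) hIcc hL

theorem isInvertible_df {x : EuclideanSpace ℝ (Fin n)} (hx : x ∈ S.X \ S.crit) :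
    (S.df x).IsInvertible := by
  by_contra h
  exact hx.2 ⟨hx.1, fun hreg => h hreg.2.2⟩

theorem continuousOn_g (hn : 1 ≤ n) (hdf : ContinuousOn S.df (S.X \ S.crit)) :
    ContinuousOn S.g (S.X \ S.crit) := by
  intro x hx
  obtain ⟨e, he⟩ := isInvertible_df hx
  have hcont : ContinuousAt ContinuousLinearMap.inverse (S.df x) := by
    rw [← he]
    exact (contDiffAt_map_inverse (n := 0) e).continuousAt
  have hne : ‖S.dfInv x‖ ≠ 0 := by
    have : Nonempty (Fin n) := ⟨⟨0, hn⟩⟩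
    rw [dfInv, ← he, ContinuousLinearMap.inverse_equiv]
    exact e.symm.norm_pos.ne'
  exact (hcont.comp_continuousWithinAt (hdf x hx)).norm.log hne

theorem abs_g_le_log (hn : 1 ≤ n) {B β : ℝ} (hB : 0 < B)
    (hbd : ∀ x ∈ S.X \ S.crit, ∀ v, 1 / B * Metric.infDist x S.crit ^ β * ‖v‖ ≤ ‖S.df x v‖ ∧
      Metric.infDist x S.crit ^ β * ‖S.df x v‖ ≤ B * ‖v‖)
    {x : EuclideanSpace ℝ (Fin n)} (hx : x ∈ S.X \ S.crit) (hd : 0 < Metric.infDist x S.crit) :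
    |S.g x| ≤ Real.log (B / Metric.infDist x S.crit ^ β) := by
  have : Nonempty (Fin n) := ⟨⟨0, hn⟩⟩
  refine abs_log_norm_inverse_le (isInvertible_df hx) (by positivity) (fun v => ?_) fun v => ?_
  · have hlow := (hbd x hx v).1
    rw [div_mul_eq_mul_div, le_div_iff₀ (by positivity)]
    rw [one_div_mul_eq_div, div_mul_eq_mul_div, div_le_iff₀ hB] at hlow
    linarith
  · rw [div_mul_eq_mul_div, le_div_iff₀' (by positivity)]
    exact (hbd x hx v).2

namespace Component

variable (C : S.Component)

theorem ae_notMem {N : Set (EuclideanSpace ℝ (Fin n))} (hN : volume N = 0) :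
    ∀ᵐ y : C.Y ∂C.reference, (y : EuclideanSpace ℝ (Fin n)) ∉ N :=
  measure_eq_zero_iff_ae_notMem.1 (nonpos_iff_eq_zero.1
    ((C.reference_preimage_le N).trans_eq (by rw [hN, mul_zero])))

theorem aestronglyMeasurable_g (hn : 1 ≤ n) (hdf : ContinuousOn S.df (S.X \ S.crit))
    (hvol : volume (closure S.crit) = 0) :
    AEStronglyMeasurable (fun y : C.Y => S.g y) C.reference := by
  have hmeas : MeasurableSet {y : C.Y | (y : EuclideanSpace ℝ (Fin n)) ∉ closure S.crit} :=
    (isClosed_closure.preimage continuous_subtype_val).measurableSet.compl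
  have hcont : ContinuousOn (fun y : C.Y => S.g y) {y : C.Y | ↑y ∉ closure S.crit} :=
    (continuousOn_g hn hdf).comp continuous_subtype_val.continuousOn
      fun y hy => ⟨C.subset_X y.2, fun h => hy (subset_closure h)⟩
  rw [← Measure.restrict_eq_self_of_ae_mem (C.ae_notMem hvol)]
  exact hcont.aestronglyMeasurable hmeas

theorem zero_mem_interior_integrableExpSet_g (hn : 1 ≤ n)
    (hdf : ContinuousOn S.df (S.X \ S.crit)) {s : ℝ} (hs : 0 < s)
    (hcrit : HasMinkowskiCodim volume S.crit s) {B β : ℝ} (hB : 0 < B) (hβ : 0 < β)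
    (hbd : ∀ x ∈ S.X \ S.crit, ∀ v, 1 / B * Metric.infDist x S.crit ^ β * ‖v‖ ≤ ‖S.df x v‖ ∧
      Metric.infDist x S.crit ^ β * ‖S.df x v‖ ≤ B * ‖v‖) :
    0 ∈ interior (integrableExpSet (fun y : C.Y => S.g y) C.reference) := by
  have hvol := hcrit.measure_closure hs
  have hmeas := C.aestronglyMeasurable_g hn hdf hvol
  rcases S.crit.eq_empty_or_nonempty with hempty | hne
  · have hcont : ContinuousOn S.g C.Y := (continuousOn_g hn hdf).mono (by
      rw [hempty, sdiff_empty]; exact C.subset_X)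
    obtain ⟨M, hM⟩ := C.isCompact_Y.exists_bound_of_continuousOn hcont
    refine zero_mem_interior_integrableExpSet hmeas one_pos ((integrable_const (Real.exp M)).mono'
      (Real.continuous_exp.comp_aestronglyMeasurable (hmeas.norm.const_mul 1))
      (.of_forall fun y => ?_))
    rw [Real.norm_eq_abs, Real.abs_exp, one_mul, Real.exp_le_exp]
    exact hM y y.2
  · obtain ⟨c, hc⟩ := hcrit
    refine zero_mem_interior_integrableExpSet_of_le_log hmeas
      (d := fun y => Metric.infDist (y : EuclideanSpace ℝ (Fin n)) S.crit)
      (c := (volume (cube n S.σ))⁻¹.toReal * c) (B := B) (β := β)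
      ((Metric.continuous_infDist_pt _).measurable.comp measurable_subtype_coe)
      (fun _ => Metric.infDist_nonneg) hs ?_ hB hβ ?_
    · filter_upwards [hc] with r hr
      have hset : {y : C.Y | Metric.infDist (y : EuclideanSpace ℝ (Fin n)) S.crit < r} =
          Subtype.val ⁻¹' Metric.thickening r S.crit := by
        ext y
        exact (Metric.mem_thickening_iff_infDist_lt hne).symm
      rw [hset, mul_assoc, ENNReal.ofReal_mul ENNReal.toReal_nonneg,
        ENNReal.ofReal_toReal (inv_volume_cube_ne_top S)]
      exact (C.reference_preimage_le _).trans (by gcongr)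
    · filter_upwards [C.ae_notMem hvol] with y hy
      have hpos := (Metric.infDist_pos_iff_notMem_closure hne).1 hy
      exact ⟨hpos, abs_g_le_log hn hB hbd
        ⟨C.subset_X y.2, fun h => hy (subset_closure h)⟩ hpos⟩

end Component
end NoisyMap

end ExponentialMomentsOfG

theorem isBigO_sq_rpow_nhdsGT_zero {p : ℝ} (hp : p ≤ 2) :
    (fun θ : ℝ => θ ^ 2) =O[𝓝[>] 0] fun θ => θ ^ p := by
  refine .of_bound' ?_
  filter_upwards [Ioo_mem_nhdsGT (zero_lt_one' ℝ)] with θ hθ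
  rw [Real.norm_of_nonneg (sq_nonneg θ), Real.norm_of_nonneg (Real.rpow_nonneg hθ.1.le p),
    ← Real.rpow_two]
  exact Real.rpow_le_rpow_of_exponent_ge hθ.1 hθ.2.le hp

theorem isBigO_one_add_sub_exp (lam : ℝ) :
    (fun θ : ℝ => (1 + θ * lam) - Real.exp (θ * lam)) =O[𝓝 0] fun θ => θ ^ 2 := by
  have h := (isBigO_sub_taylor_one (f := fun θ : ℝ => Real.exp (θ * lam)) (x := 0)
    (by fun_prop)).neg_left
  have hderiv : deriv (fun θ : ℝ => Real.exp (θ * lam)) 0 = lam := by simp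
  simpa [hderiv] using h

end RandomHorseshoe

end

theorem proposition3p3_general {n : ℕ} (hn : 1 ≤ n) (S : RandomHorseshoe.NoisyMap n)
    (hdf : ContinuousOn S.df (S.X \ S.crit)) {s : ℝ} (hs : 0 < s)
    (hcrit : RandomHorseshoe.HasMinkowskiCodim volume S.crit s) {B β : ℝ} (hB : 0 < B) (hβ : 0 < β)
    (hbd : ∀ x ∈ S.X \ S.crit, ∀ v, 1 / B * Metric.infDist x S.crit ^ β * ‖v‖ ≤ ‖S.df x v‖ ∧
      Metric.infDist x S.crit ^ β * ‖S.df x v‖ ≤ B * ‖v‖)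
    (C : S.Component) (μ : Measure C.Y) (hμ : C.IsUniquelyErgodic μ) :
    ∃ lam : ℝ → ℝ,
      (∀ᶠ θ in 𝓝 0, ∃ T : C(C.Y, ℂ) →L[ℂ] C(C.Y, ℂ),
        C.IsTwistedTransferOperator θ T ∧ RandomHorseshoe.IsLeadingEigenvalue T (lam θ)) ∧
      (fun θ => lam θ - (1 + θ * C.exponent μ)) =O[𝓝 0] (fun θ => θ ^ 2) ∧
      (fun θ => lam θ - Real.exp (θ * C.exponent μ)) =O[𝓝 0] (fun θ => θ ^ 2) := by
  have : Nonempty C.Y := C.nonempty_Y.to_subtype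
  have := hμ.isProbabilityMeasure
  have hg := C.zero_mem_interior_integrableExpSet_g hn hdf hs hcrit hB hβ hbd
  obtain ⟨lam, hlam, hexp⟩ := C.isContinuousInMeasure.exists_isLeadingEigenvalue_average_exp
    C.reference_reachable (C.isStationary_iff.1 hμ.isStationary)
    (fun m hm hinv => hμ.unique m hm (C.isStationary_iff.2 hinv)) hg
  refine ⟨lam, ?_, hexp,
    (hexp.add (RandomHorseshoe.isBigO_one_add_sub_exp (C.exponent μ))).congr_left
      fun θ => sub_add_sub_cancel _ _ _⟩
  filter_upwards [hlam, mem_interior_iff_mem_nhds.1 hg] with θ hθ hint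
  exact ⟨_, C.isTwistedTransferOperator_average hint, hθ⟩

theorem proposition3p3 {n : ℕ} (hn : 1 ≤ n) (S : RandomHorseshoe.NoisyMap n)
    (hf : S.IsC1Holder) (hcrit : S.NondegenerateCrit)
    (C : S.Component) (μ : Measure C.Y) (hμ : C.IsUniquelyErgodic μ)
    (hneg : C.exponent μ < 0) :
    ∃ lam : ℝ → ℝ,
      (∀ᶠ θ in 𝓝[>] (0 : ℝ), ∃ T : C(C.Y, ℂ) →L[ℂ] C(C.Y, ℂ),
        C.IsTwistedTransferOperator θ T ∧ RandomHorseshoe.IsLeadingEigenvalue T (lam θ)) ∧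
      (fun θ => lam θ - (1 + θ * C.exponent μ)) =O[𝓝[>] 0] (fun θ => θ ^ (4 / 3 : ℝ)) ∧
      (fun θ => lam θ - Real.exp (θ * C.exponent μ)) =O[𝓝[>] 0]
        (fun θ => θ ^ (4 / 3 : ℝ)) := by
  obtain ⟨B, β, hB, hβ, hbd, -⟩ := hcrit.exists_bounds
  obtain ⟨lam, hlam, hlin, hexp⟩ := proposition3p3_general hn S hf.continuousOn_df
    one_pos (hcrit.hasMinkowskiCodim hn) (one_pos.trans hB) hβ hbd C μ hμ
  have hsq := RandomHorseshoe.isBigO_sq_rpow_nhdsGT_zero (p := 4 / 3) (by norm_num)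
  exact ⟨lam, nhdsWithin_le_nhds hlam, (hlin.mono nhdsWithin_le_nhds).trans hsq,
    (hexp.mono nhdsWithin_le_nhds).trans hsq⟩
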